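/- Theorem (Bias magnitude of persistent sampling). Let $\pi$ be a prior probability measure on a measurable space $\Theta$, let $\mathcal L:\Theta\to(0,\infty)$ be a measurable likelihood, and let $0=\beta_1<\beta_2<\dots<\beta_T=1$ be a fixed temperature schedule. For $1\le t\le T$ put $$\mathcal Z_t=\int \mathcal L^{\beta_t}\,d\pi,\qquad p_t(d\theta)=\mathcal L(\theta)^{\beta_t}\,\pi(d\theta)/\mathcal Z_t,$$ and let $\mathcal K_t$ be a Markov kernel on $\Theta$ with invariant law $p_t$. Persistent sampling (PS) with $N\ge1$ particles per iteration is the following procedure. The particles $\theta_1^1,\dots,\theta_1^N$ are i.i.d. from $\pi$, and $\hat{\mathcal Z}_1=1$. At each iteration $t\ge2$ put, for $1\le t'\le t-1$ and $1\le i\le N$, $$w_{tt'}^i=\frac{\mathcal L(\theta_{t'}^i)^{\beta_t}}{\frac1{t-1}\sum_{s=1}^{t-1}\mathcal L(\theta_{t'}^i)^{\beta_s}\hat{\mathcal Z}_s^{-1}},\qquad \hat{\mathcal Z}_t=\frac1{t-1}\sum_{t'=1}^{t-1}\frac1N\sum_{i=1}^N w_{tt'}^i ;$$ then, conditionally on all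 particles of iterations $1,\dots,t-1$, the particles $\theta_t^1,\dots,\theta_t^N$ are drawn independently, each by choosing one of the $(t-1)N$ earlier particles $\theta_{t'}^i$ with probability proportional to $w_{tt'}^i$ (multinomial resampling) and moving it by $\mathcal K_t$. Assume: (C1) for all $1\le t,s\le T$: $\sup_{\theta\in\Theta}\mathcal L(\theta)^{\beta_t}/\mathcal L(\theta)^{\beta_s}\le M_{ts}<\infty$; (C2) there is $\epsilon>0$ with $\mathcal Z_t\ge\epsilon$ for all $t\le T$; (C3) for each $t\le T$ there are $A_t<\infty$ and $\rho_t\in(0,1)$ with $\sup_{\theta}\|\mathcal K_t^n(\theta,\cdot)-p_t\|_{TV}\le A_t\rho_t^n$ for all $n\ge1$; (C4) there is $\delta>0$ with $\beta_t-\beta_{t-1}\ge\delta$ for $2\le t\le T$. Then for every $t$ with $3\le t\le T$ there are constants $C_t$ and $D_t$ that depend only on $t$, on the temperatures $(\beta_s)_{s\le t}$ and on the likelihood ratio bounds $(M_{sr})_{s,r\le t}$ such that, for every $N\ge1$, $\hat{\mathcal Z}_t$ is integrable and $$\left|\frac{\mathbb E[\hat{\mathcal Z}_t]}{\mathcal Z_t}-1\right|\le\frac{C_t}{N}+\frac{D_t}{N^2}.$$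 -/

import Mathlib

open MeasureTheory ProbabilityTheory

namespace PersistentSampling

/-- The data of persistent sampling: a prior, a (strictly positive, measurable) likelihood, a
temperature schedule `β 1, β 2, …` and for each iteration `t` an MCMC transition kernel `K t`. -/
structure Sampler (Θ : Type*) [MeasurableSpace Θ] where
  prior : Measure Θ
  isProbabilityMeasure_prior : IsProbabilityMeasure prior
  L : Θ → ℝ
  measurable_L : Measurable L
  L_pos : ∀ x, 0 < L x
  β : ℕ → ℝ
  K : ℕ → Kernel Θ Θ
  isMarkovKernel_K : ∀ t, IsMarkovKernel (K t)

attribute [instance] Sampler.isProbabilityMeasure_prior Sampler.isMarkovKernel_K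

/-- Total variation distance of two finite measures, `sup_A |μ(A) - ν(A)|`. -/
noncomputable def tvDist {Θ : Type*} [MeasurableSpace Θ] (μ ν : Measure Θ) : ℝ :=
  ⨆ A : {A : Set Θ // MeasurableSet A}, |μ.real A.1 - ν.real A.1|

namespace Sampler

variable {Θ : Type*} [MeasurableSpace Θ] (S : Sampler Θ) {N : ℕ}

/-- The normalizing constant `Z_t = ∫ L(x)^{β_t} dπ(x)`. -/
noncomputable def Z (t : ℕ) : ℝ := ∫ x, S.L x ^ S.β t ∂S.prior

/-- The annealed target `p_t = L^{β_t} π / Z_t`. -/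
noncomputable def target (t : ℕ) : Measure Θ :=
  S.prior.withDensity fun x => ENNReal.ofReal (S.L x ^ S.β t / S.Z t)

/-- The estimate `Ẑ_t` of `Z_t` computed from the particles; `θ s i` is the `i`-th particle of
iteration `s` (with `s = 1, 2, …`). `Ẑ_1 = 1`, and for `t ≥ 2`
`Ẑ_t = (t-1)⁻¹ ∑_{t'=1}^{t-1} N⁻¹ ∑_i w_{tt'}^i` with
`w_{tt'}^i = L(θ_{t'}^i)^{β_t} / ((t-1)⁻¹ ∑_{s=1}^{t-1} L(θ_{t'}^i)^{β_s} Ẑ_s⁻¹)`;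
see `Zhat_one` and `Zhat_of_two_le`. -/
noncomputable def Zhat (θ : ℕ → Fin N → Θ) (t : ℕ) : ℝ :=
  if t ≤ 1 then 1 else
    1 / ((t : ℝ) - 1) * ∑ t' ∈ Finset.Icc 1 (t - 1), 1 / (N : ℝ) * ∑ i : Fin N,
      S.L (θ t' i) ^ S.β t / (1 / ((t : ℝ) - 1) *
        ∑ s : Finset.Icc 1 (t - 1), S.L (θ t' i) ^ S.β s.1 * (Zhat θ s.1)⁻¹)
termination_by t
decreasing_by
  have := Finset.mem_Icc.1 s.2
  omega

/-- The unnormalized persistent weight at iteration `t` of a particle located at `x`: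
`w_{tt'}^i = S.weight θ t (θ t' i)`. -/
noncomputable def weight (θ : ℕ → Fin N → Θ) (t : ℕ) (x : Θ) : ℝ :=
  S.L x ^ S.β t /
    (1 / ((t : ℝ) - 1) * ∑ s ∈ Finset.Icc 1 (t - 1), S.L x ^ S.β s * (S.Zhat θ s)⁻¹)

theorem Zhat_one (θ : ℕ → Fin N → Θ) : S.Zhat θ 1 = 1 := by
  rw [Zhat, if_pos le_rfl]

theorem Zhat_of_two_le (θ : ℕ → Fin N → Θ) {t : ℕ} (ht : 2 ≤ t) :
    S.Zhat θ t = 1 / ((t : ℝ) - 1) * ∑ t' ∈ Finset.Icc 1 (t - 1),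
      1 / (N : ℝ) * ∑ i : Fin N, S.weight θ t (θ t' i) := by
  rw [Zhat, if_neg (by omega)]
  refine congrArg _ (Finset.sum_congr rfl fun t' _ => congrArg _ (Finset.sum_congr rfl fun i _ => ?_))
  rw [weight, Finset.sum_coe_sort (Finset.Icc 1 (t - 1))
    (fun s => S.L (θ t' i) ^ S.β s * (S.Zhat θ s)⁻¹)]

/-- The reweighted persistent ensemble at iteration `t`: the probability measure that puts on
each of the `(t-1) N` particles `θ_{t'}^i`, `t' < t`, a mass proportional to its weight
`W_{tt'}^i = w_{tt'}^i / Ẑ_t`. -/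
noncomputable def ensemble (θ : ℕ → Fin N → Θ) (t : ℕ) : Measure Θ :=
  ∑ t' ∈ Finset.Icc 1 (t - 1), ∑ i : Fin N,
    ENNReal.ofReal (S.weight θ t (θ t' i) / S.Zhat θ t / (((t : ℝ) - 1) * N)) •
      Measure.dirac (θ t' i)

/-- The law of the `N` particles of iteration `t` given those of the iterations before `t`:
independently for each particle, draw a state from the reweighted persistent ensemble
(multinomial resampling) and move it with the MCMC kernel `K t`. -/
noncomputable def nextLaw (θ : ℕ → Fin N → Θ) (t : ℕ) : Measure (Fin N → Θ) :=
  Measure.pi fun _ => (S.ensemble θ t).bind (S.K t)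

theorem Zhat_pos [NeZero N] (θ : ℕ → Fin N → Θ) (t : ℕ) : 0 < S.Zhat θ t := by
  induction t using Nat.strong_induction_on with
  | _ t ih =>
    by_cases ht : t ≤ 1
    · rw [Zhat, if_pos ht]; exact one_pos
    · have hne : (Finset.Icc 1 (t - 1)).Nonempty := ⟨1, Finset.mem_Icc.2 ⟨le_rfl, by omega⟩⟩
      have h1 : 0 < 1 / ((t : ℝ) - 1) := by
        have : (1 : ℝ) < t := by exact_mod_cast (by omega : 1 < t)
        exact one_div_pos.2 (by linarith)
      have h2 : 0 < 1 / (N : ℝ) :=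
        one_div_pos.2 (by exact_mod_cast Nat.pos_of_ne_zero (NeZero.ne N))
      rw [Zhat_of_two_le _ _ (by omega)]
      refine mul_pos h1 (Finset.sum_pos (fun t' _ => mul_pos h2 (Finset.sum_pos (fun i _ => ?_)
        Finset.univ_nonempty)) hne)
      refine div_pos (Real.rpow_pos_of_pos (S.L_pos _) _)
        (mul_pos h1 (Finset.sum_pos (fun s hs => ?_) hne))
      have := Finset.mem_Icc.1 hs
      exact mul_pos (Real.rpow_pos_of_pos (S.L_pos _) _) (inv_pos.2 (ih s (by omega)))

theorem weight_pos [NeZero N] (θ : ℕ → Fin N → Θ) {t : ℕ} (ht : 2 ≤ t) (x : Θ) :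
    0 < S.weight θ t x := by
  have hne : (Finset.Icc 1 (t - 1)).Nonempty := ⟨1, Finset.mem_Icc.2 ⟨le_rfl, by omega⟩⟩
  have h1 : 0 < 1 / ((t : ℝ) - 1) := by
    have : (1 : ℝ) < t := by exact_mod_cast (by omega : 1 < t)
    exact one_div_pos.2 (by linarith)
  exact div_pos (Real.rpow_pos_of_pos (S.L_pos _) _) (mul_pos h1 (Finset.sum_pos (fun s _ =>
    mul_pos (Real.rpow_pos_of_pos (S.L_pos _) _) (inv_pos.2 (S.Zhat_pos θ s))) hne))

theorem measurable_weight {α : Type*} [MeasurableSpace α] {θ : α → ℕ → Fin N → Θ} {x : α → Θ}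
    (hx : Measurable x) {t : ℕ}
    (hZ : ∀ s ∈ Finset.Icc 1 (t - 1), Measurable fun a => S.Zhat (θ a) s) :
    Measurable fun a => S.weight (θ a) t (x a) := by
  have hL : Measurable fun a => S.L (x a) := S.measurable_L.comp hx
  refine (hL.pow_const _).div (measurable_const.mul ?_)
  exact Finset.measurable_fun_sum _ fun s hs => (hL.pow_const _).mul (hZ s hs).inv

theorem measurable_Zhat (t : ℕ) : Measurable fun θ : ℕ → Fin N → Θ => S.Zhat θ t := by
  induction t using Nat.strong_induction_on with
  | _ t ih =>
    by_cases ht : t ≤ 1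
    · have : (fun θ : ℕ → Fin N → Θ => S.Zhat θ t) = fun _ => 1 := by
        funext θ; rw [Zhat, if_pos ht]
      rw [this]; exact measurable_const
    · simp_rw [S.Zhat_of_two_le _ (show 2 ≤ t by omega)]
      refine measurable_const.mul (Finset.measurable_fun_sum _ fun t' _ => measurable_const.mul
        (Finset.measurable_fun_sum _ fun i _ => S.measurable_weight (by fun_prop) fun s hs => ?_))
      have := Finset.mem_Icc.1 hs
      exact ih s (by omega)

theorem isProbabilityMeasure_ensemble [NeZero N] (θ : ℕ → Fin N → Θ) {t : ℕ} (ht : 2 ≤ t) :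
    IsProbabilityMeasure (S.ensemble θ t) := by
  constructor
  have h1 : 0 < (t : ℝ) - 1 := by
    have : (1 : ℝ) < t := by exact_mod_cast (by omega : 1 < t)
    linarith
  have h2 : 0 < (N : ℝ) := by exact_mod_cast Nat.pos_of_ne_zero (NeZero.ne N)
  have hw : ∀ t' i, 0 ≤ S.weight θ t (θ t' i) / S.Zhat θ t / (((t : ℝ) - 1) * N) := fun t' i =>
    div_nonneg (div_nonneg (S.weight_pos θ ht _).le (S.Zhat_pos θ t).le) (mul_pos h1 h2).le
  simp only [ensemble, Measure.coe_finsetSum, Finset.sum_apply, Measure.smul_apply,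
    measure_univ, smul_eq_mul, mul_one]
  simp_rw [← ENNReal.ofReal_sum_of_nonneg (fun i (_ : i ∈ Finset.univ) => hw _ i)]
  rw [← ENNReal.ofReal_sum_of_nonneg (fun t' _ => Finset.sum_nonneg fun i _ => hw t' i)]
  simp_rw [← Finset.sum_div]
  have hZ := S.Zhat_of_two_le θ ht
  rw [← Finset.mul_sum] at hZ
  have hsum : ∑ t' ∈ Finset.Icc 1 (t - 1), ∑ i : Fin N, S.weight θ t (θ t' i) =
      S.Zhat θ t * (((t : ℝ) - 1) * N) := by
    rw [hZ]; field_simp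
  rw [hsum, div_right_comm, mul_div_assoc, div_self (mul_pos h1 h2).ne', mul_one,
    div_self (S.Zhat_pos θ t).ne', ENNReal.ofReal_one]

theorem isProbabilityMeasure_nextLaw [NeZero N] (θ : ℕ → Fin N → Θ) {t : ℕ} (ht : 2 ≤ t) :
    IsProbabilityMeasure (S.nextLaw θ t) := by
  have := S.isProbabilityMeasure_ensemble θ ht
  have : IsProbabilityMeasure ((S.ensemble θ t).bind (S.K t)) :=
    isProbabilityMeasure_bind (S.K t).measurable.aemeasurable
      (Filter.Eventually.of_forall fun _ => inferInstance)
  unfold nextLaw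
  infer_instance

theorem measurable_nextLaw [NeZero N] {t : ℕ} (ht : 2 ≤ t) :
    Measurable fun θ : ℕ → Fin N → Θ => S.nextLaw θ t := by
  have := fun θ : ℕ → Fin N → Θ => S.isProbabilityMeasure_nextLaw θ ht
  have hE : Measurable fun θ : ℕ → Fin N → Θ => S.ensemble θ t := by
    refine Measure.measurable_of_measurable_coe _ fun A hA => ?_
    simp only [ensemble, Measure.coe_finsetSum, Finset.sum_apply, Measure.smul_apply, smul_eq_mul]
    refine Finset.measurable_fun_sum _ fun t' _ => Finset.measurable_fun_sum _ fun i _ => ?_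
    refine Measurable.mul (ENNReal.measurable_ofReal.comp (Measurable.div_const (Measurable.div
      (S.measurable_weight (by fun_prop) fun s _ => S.measurable_Zhat s) (S.measurable_Zhat t)) _))
      ((Measure.measurable_coe hA).comp (Measure.measurable_dirac.comp (by fun_prop)))
  have hB : Measurable fun θ : ℕ → Fin N → Θ => (S.ensemble θ t).bind (S.K t) :=
    (Measure.measurable_bind' (S.K t).measurable).comp hE
  refine Measurable.measure_of_isPiSystem_of_isProbabilityMeasure generateFrom_pi.symm
    isPiSystem_pi ?_
  rintro _ ⟨A, hA, rfl⟩
  have hp : ∀ θ : ℕ → Fin N → Θ, IsProbabilityMeasure ((S.ensemble θ t).bind (S.K t)) := fun θ =>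
    have := S.isProbabilityMeasure_ensemble θ ht
    isProbabilityMeasure_bind (S.K t).measurable.aemeasurable
      (Filter.Eventually.of_forall fun _ => inferInstance)
  simp_rw [nextLaw, Measure.pi_pi]
  exact Finset.measurable_fun_prod _ fun i _ =>
    (Measure.measurable_coe (hA i (Set.mem_univ i))).comp hB

/-- A history whose entry number `k = 0, …, n` is the particle population of iteration `k + 1`,
renumbered so that the population of iteration `s` is entry `s`, for `s = 1, …, n + 1`. The
entries outside this range are irrelevant. -/
def renumber (n : ℕ) (h : (i : Finset.Iic n) → (Fin N → Θ)) : ℕ → Fin N → Θ :=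
  fun s => h ⟨min (s - 1) n, Finset.mem_Iic.2 (min_le_right _ _)⟩

/-- One iteration of the algorithm as a Markov kernel from the particles of iterations
`1, …, n + 1` to those of iteration `n + 2`. -/
noncomputable def step (N : ℕ) [NeZero N] (n : ℕ) :
    Kernel ((i : Finset.Iic n) → (Fin N → Θ)) (Fin N → Θ) where
  toFun h := S.nextLaw (renumber n h) (n + 2)
  measurable' := (S.measurable_nextLaw (by omega)).comp
    (measurable_pi_lambda _ fun _ => measurable_pi_apply _)

instance (N : ℕ) [NeZero N] (n : ℕ) : IsMarkovKernel (S.step N n) :=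
  ⟨fun h => S.isProbabilityMeasure_nextLaw (renumber n h) (by omega)⟩

/-- The law of all the particles `θ_s^i`, `s = 1, 2, …`, of persistent sampling with `N` particles
per iteration, as a probability measure on `ℕ → Fin N → Θ` (`θ s i` is the `i`-th particle of
iteration `s`; the entry `θ 0` is irrelevant). The first `N` particles are independent draws from
the prior. -/
noncomputable def law (N : ℕ) [NeZero N] : Measure (ℕ → Fin N → Θ) :=
  (Kernel.trajMeasure (X := fun _ => Fin N → Θ) (Measure.pi fun _ => S.prior) (S.step N)).map
    fun x s => x (s - 1)

/-- The standing assumptions on an annealing run with iterations `1, …, T` and the four technical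
conditions: bounded likelihood ratios (with bounds `M t s`), normalizing constants bounded away
from zero, uniformly geometrically ergodic MCMC kernels, temperature steps bounded away from
zero. -/
structure Conditions (T : ℕ) (M : ℕ → ℕ → ℝ) : Prop where
  β_one : S.β 1 = 0
  β_last : S.β T = 1
  invariant : ∀ t ∈ Finset.Icc 1 T, Kernel.Invariant (S.K t) (S.target t)
  likelihood_ratio : ∀ t ∈ Finset.Icc 1 T, ∀ s ∈ Finset.Icc 1 T, ∀ x,
    S.L x ^ S.β t / S.L x ^ S.β s ≤ M t s
  normalizing : ∃ ε > 0, ∀ t ∈ Finset.Icc 1 T, ε ≤ S.Z t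
  ergodic : ∀ t ∈ Finset.Icc 1 T, ∃ C : ℝ, ∃ ρ ∈ Set.Ioo (0 : ℝ) 1, ∀ n : ℕ, 1 ≤ n → ∀ x,
    tvDist ((S.K t ^ n) x) (S.target t) ≤ C * ρ ^ n
  schedule : ∃ δ > 0, ∀ t ∈ Finset.Icc 2 T, δ ≤ S.β t - S.β (t - 1)

end Sampler

end PersistentSampling

/-! The bias is of order `1/N` because every error in the algorithm is bounded and has both mean and
second moment `O(1/N)`. Such errors, formalized by `SmallError`, are stable under bounded linear
combinations, under products, and under smooth operations such as inversion away from zero: the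
first-order term keeps its `O(1/N)` mean, and the remainder is quadratic, hence controlled by second
moments. No independence between factors is needed, so it does not matter that old particles
correlate with the `Ẑ_s` in their weights.

By induction on `t`, the empirical mean of every bounded test function at iteration `t`
(`PopulationConsistent`) and `Ẑ_t` (`ConstantConsistent`) have small error. The weights are
linearized in `Ẑ_s⁻¹ - Z_s⁻¹` (`smallError_weighted`). With exact constants, the denominator is the
density of the mixture of earlier targets, so it cancels and leaves the unnormalized target. A new
population is a conditionally centered i.i.d. fluctuation plus a ratio of weighted averages, whose
limit is identified by invariance of the MCMC kernel.

Since `β_1 = 0`, the likelihood ratio bounds confine each `L^{β_s}` to an interval `[B⁻¹, B]`, which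
makes weights and estimates bounded above and below. Uniformity of the constants comes from running
the argument on a family indexed by all instances with the same `B`. -/

namespace PersistentSampling

/-! ### Calculus of errors with small mean and second moment -/

section SmallError

variable {ι : Type*} {Ω : ι → Type*} [∀ i, MeasurableSpace (Ω i)]

/-- A family of random variables `X i` that is uniformly bounded and whose means and second
moments are `O(ε i)`, uniformly in `i`. -/
structure SmallError (P : ∀ i, Measure (Ω i)) (ε : ι → ℝ) (X : ∀ i, Ω i → ℝ) : Prop where
  measurable : ∀ i, Measurable (X i)
  bounded : ∃ c, ∀ i ω, |X i ω| ≤ c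
  bias : ∃ c, ∀ i, |∫ ω, X i ω ∂P i| ≤ c * ε i
  meanSq : ∃ c, ∀ i, ∫ ω, X i ω ^ 2 ∂P i ≤ c * ε i

theorem integrable_of_abs_le {α : Type*} [MeasurableSpace α] {μ : Measure α} [IsFiniteMeasure μ]
    {f : α → ℝ} (hf : Measurable f) {c : ℝ} (hc : ∀ x, |f x| ≤ c) : Integrable f μ :=
  Integrable.of_bound hf.aestronglyMeasurable c (Filter.Eventually.of_forall hc)

theorem abs_integral_le_of_abs_le {α : Type*} [MeasurableSpace α] {μ : Measure α}
    [IsProbabilityMeasure μ] {f : α → ℝ} {c : ℝ} (hc : ∀ x, |f x| ≤ c) :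
    |∫ x, f x ∂μ| ≤ c := by
  simpa using norm_integral_le_of_norm_le_const (μ := μ) (f := f) (Filter.Eventually.of_forall hc)

namespace SmallError

variable {P : ∀ i, Measure (Ω i)} {ε : ι → ℝ} {X Y : ∀ i, Ω i → ℝ}

theorem zero (P : ∀ i, Measure (Ω i)) (ε : ι → ℝ) : SmallError P ε fun _ _ => 0 :=
  ⟨fun _ => measurable_const, ⟨0, by simp⟩, ⟨0, by simp⟩, ⟨0, by simp⟩⟩

theorem congr (hX : SmallError P ε X) (h : ∀ i ω, Y i ω = X i ω) : SmallError P ε Y := by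
  rwa [show Y = X from funext fun i => funext fun ω => h i ω]

theorem const_mul (hX : SmallError P ε X) {a : ι → ℝ} {A : ℝ}
    (hA : ∀ i, |a i| ≤ A) : SmallError P ε fun i ω => a i * X i ω := by
  obtain ⟨b, hb⟩ := hX.bounded
  obtain ⟨b₁, hb₁⟩ := hX.bias
  obtain ⟨b₂, hb₂⟩ := hX.meanSq
  refine ⟨fun i => (hX.measurable i).const_mul _, ⟨A * b, fun i ω => ?_⟩,
    ⟨A * b₁, fun i => ?_⟩, ⟨A ^ 2 * b₂, fun i => ?_⟩⟩
  · rw [abs_mul]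
    exact mul_le_mul (hA i) (hb i ω) (abs_nonneg _) ((abs_nonneg _).trans (hA i))
  · rw [integral_const_mul, abs_mul, mul_assoc]
    exact mul_le_mul (hA i) (hb₁ i) (abs_nonneg _) ((abs_nonneg _).trans (hA i))
  · simp_rw [mul_pow]
    rw [integral_const_mul, mul_assoc, ← sq_abs (a i)]
    exact mul_le_mul (pow_le_pow_left₀ (abs_nonneg _) (hA i) 2) (hb₂ i)
      (integral_nonneg fun ω => sq_nonneg _) (sq_nonneg _)

variable [∀ i, IsProbabilityMeasure (P i)]

theorem integrable (hX : SmallError P ε X) (i : ι) : Integrable (X i) (P i) :=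
  integrable_of_abs_le (hX.measurable i) (hX.bounded.choose_spec i)

theorem integrable_sq (hX : SmallError P ε X) (i : ι) :
    Integrable (fun ω => X i ω ^ 2) (P i) := by
  obtain ⟨c, hc⟩ := hX.bounded
  refine integrable_of_abs_le (c := c ^ 2) ((hX.measurable i).pow_const 2) fun ω => ?_
  rw [abs_pow]
  exact pow_le_pow_left₀ (abs_nonneg _) (hc i ω) 2

theorem add (hX : SmallError P ε X) (hY : SmallError P ε Y) :
    SmallError P ε fun i ω => X i ω + Y i ω := by
  obtain ⟨a, ha⟩ := hX.bounded
  obtain ⟨b, hb⟩ := hY.bounded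
  obtain ⟨a₁, ha₁⟩ := hX.bias
  obtain ⟨b₁, hb₁⟩ := hY.bias
  obtain ⟨a₂, ha₂⟩ := hX.meanSq
  obtain ⟨b₂, hb₂⟩ := hY.meanSq
  have hm : ∀ i, Measurable fun ω => X i ω + Y i ω := fun i =>
    (hX.measurable i).add (hY.measurable i)
  have hbd : ∀ i ω, |X i ω + Y i ω| ≤ a + b := fun i ω =>
    (abs_add_le _ _).trans (add_le_add (ha i ω) (hb i ω))
  refine ⟨hm, ⟨a + b, hbd⟩, ⟨a₁ + b₁, fun i => ?_⟩, ⟨2 * (a₂ + b₂), fun i => ?_⟩⟩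
  · rw [integral_add (hX.integrable i) (hY.integrable i), add_mul]
    exact (abs_add_le _ _).trans (add_le_add (ha₁ i) (hb₁ i))
  · calc ∫ ω, (X i ω + Y i ω) ^ 2 ∂P i
        ≤ ∫ ω, 2 * (X i ω ^ 2 + Y i ω ^ 2) ∂P i :=
          integral_mono_of_nonneg (Filter.Eventually.of_forall fun ω => sq_nonneg _)
            (((hX.integrable_sq i).add (hY.integrable_sq i)).const_mul 2)
            (Filter.Eventually.of_forall fun ω => by
              dsimp only
              nlinarith [sq_nonneg (X i ω - Y i ω)])
      _ = 2 * (∫ ω, X i ω ^ 2 ∂P i + ∫ ω, Y i ω ^ 2 ∂P i) := by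
          rw [integral_const_mul, integral_add (hX.integrable_sq i) (hY.integrable_sq i)]
      _ ≤ 2 * (a₂ + b₂) * ε i := by linarith [ha₂ i, hb₂ i]

theorem sum {κ : Type*} (s : Finset κ) {X : κ → ∀ i, Ω i → ℝ}
    (hX : ∀ k ∈ s, SmallError P ε (X k)) :
    SmallError P ε fun i ω => ∑ k ∈ s, X k i ω := by
  classical
  induction s using Finset.induction_on with
  | empty => simpa using zero P ε
  | insert k s hk ih =>
    simp_rw [Finset.sum_insert hk]
    exact (hX k (Finset.mem_insert_self k s)).add
      (ih fun j hj => hX j (Finset.mem_insert_of_mem hj))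

/-- A remainder that is quadratic in small errors is a small error. -/
theorem of_abs_le_sum_sq {κ : Type*} {s : Finset κ} {Y : κ → ∀ i, Ω i → ℝ}
    (hY : ∀ k ∈ s, SmallError P ε (Y k)) (hm : ∀ i, Measurable (X i)) {A : ℝ}
    (hX : ∀ i ω, |X i ω| ≤ A * ∑ k ∈ s, Y k i ω ^ 2) : SmallError P ε X := by
  -- A negative `A` makes the bound nonpositive, so the bound with `A = 0` also holds.
  wlog hA : 0 ≤ A generalizing A
  · refine this (A := 0) (fun i ω => (hX i ω).trans ?_) le_rfl
    exact mul_le_mul_of_nonneg_right (not_le.1 hA).le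
      (Finset.sum_nonneg fun k _ => sq_nonneg _)
  choose! b hb using fun k hk => (hY k hk).bounded
  choose! c hc using fun k hk => (hY k hk).meanSq
  have hbd : ∀ i ω, |X i ω| ≤ A * ∑ k ∈ s, b k ^ 2 := fun i ω => by
    refine (hX i ω).trans (mul_le_mul_of_nonneg_left (Finset.sum_le_sum fun k hk => ?_) hA)
    rw [← sq_abs]
    exact pow_le_pow_left₀ (abs_nonneg _) (hb k hk i ω) 2
  have hint : ∀ i, ∫ ω, |X i ω| ∂P i ≤ A * (∑ k ∈ s, c k) * ε i := fun i =>
    calc ∫ ω, |X i ω| ∂P i ≤ ∫ ω, A * ∑ k ∈ s, Y k i ω ^ 2 ∂P i :=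
          integral_mono_of_nonneg (Filter.Eventually.of_forall fun ω => abs_nonneg _)
            ((integrable_finsetSum _ fun k hk => (hY k hk).integrable_sq i).const_mul A)
            (Filter.Eventually.of_forall fun ω => hX i ω)
      _ = A * ∑ k ∈ s, ∫ ω, Y k i ω ^ 2 ∂P i := by
          rw [integral_const_mul, integral_finsetSum _ fun k hk => (hY k hk).integrable_sq i]
      _ ≤ A * (∑ k ∈ s, c k) * ε i := by
          rw [mul_assoc, Finset.sum_mul]
          exact mul_le_mul_of_nonneg_left (Finset.sum_le_sum fun k hk => hc k hk i) hA
  have hB : 0 ≤ A * ∑ k ∈ s, b k ^ 2 :=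
    mul_nonneg hA (Finset.sum_nonneg fun k _ => sq_nonneg _)
  refine ⟨hm, ⟨_, hbd⟩, ⟨_, fun i => (abs_integral_le_integral_abs).trans (hint i)⟩,
    ⟨(A * ∑ k ∈ s, b k ^ 2) * (A * ∑ k ∈ s, c k), fun i => ?_⟩⟩
  -- Since `X` is bounded, its second moment is at most a constant times its first absolute moment,
  -- which also controls the bias.
  calc ∫ ω, X i ω ^ 2 ∂P i ≤ ∫ ω, (A * ∑ k ∈ s, b k ^ 2) * |X i ω| ∂P i :=
        integral_mono_of_nonneg (Filter.Eventually.of_forall fun ω => sq_nonneg _)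
          ((integrable_of_abs_le (hm i) (hbd i)).abs.const_mul _)
          (Filter.Eventually.of_forall fun ω => by
            dsimp only
            rw [← sq_abs, sq]
            exact mul_le_mul_of_nonneg_right (hbd i ω) (abs_nonneg _))
    _ ≤ _ := by
        rw [integral_const_mul, mul_assoc (A * ∑ k ∈ s, b k ^ 2)]
        exact mul_le_mul_of_nonneg_left (hint i) hB

theorem of_abs_le_sq (hY : SmallError P ε Y) (hm : ∀ i, Measurable (X i)) {A : ℝ}
    (hX : ∀ i ω, |X i ω| ≤ A * Y i ω ^ 2) : SmallError P ε X :=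
  of_abs_le_sum_sq (s := {()}) (Y := fun _ => Y) (fun _ _ => hY) hm (by simpa using hX)

/-- Since `|XY| ≤ X² + Y²`, a product is itself a quadratic remainder, whatever the dependence
between the factors. -/
theorem mul (hX : SmallError P ε X) (hY : SmallError P ε Y) :
    SmallError P ε fun i ω => X i ω * Y i ω := by
  refine of_abs_le_sum_sq (s := Finset.univ) (Y := fun k : Bool => if k then X else Y) (A := 1)
    (fun k _ => by cases k <;> simpa) (fun i => (hX.measurable i).mul (hY.measurable i))
    fun i ω => ?_
  simp only [Fintype.sum_bool, if_true, Bool.false_eq_true, if_false]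
  rw [abs_le]
  constructor <;> nlinarith [sq_nonneg (X i ω - Y i ω), sq_nonneg (X i ω + Y i ω)]

theorem mul_sub_mul {x y : ι → ℝ} {a b : ℝ} (ha : ∀ i, |x i| ≤ a)
    (hb : ∀ i, |y i| ≤ b) (hX : SmallError P ε fun i ω => X i ω - x i)
    (hY : SmallError P ε fun i ω => Y i ω - y i) :
    SmallError P ε fun i ω => X i ω * Y i ω - x i * y i :=
  (((hY.const_mul ha).add (hX.const_mul hb)).add (hX.mul hY)).congr fun i ω => by ring

/-- With `d = X - x`, one has `X⁻¹ - x⁻¹ = -d/x² + d²/(x²X)`. A Lipschitz bound alone would only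
give a bias of order `√ε`; keeping the linear term exact preserves order `ε`. -/
theorem inv_sub_inv {x : ι → ℝ} {b : ℝ} (hb : 0 < b)
    (hbx : ∀ i, b ≤ x i) (hbX : ∀ i ω, b ≤ X i ω)
    (hX : SmallError P ε fun i ω => X i ω - x i) :
    SmallError P ε fun i ω => (X i ω)⁻¹ - (x i)⁻¹ := by
  have hx : ∀ i, 0 < x i := fun i => hb.trans_le (hbx i)
  have hX0 : ∀ i ω, 0 < X i ω := fun i ω => hb.trans_le (hbX i ω)
  have h1 : SmallError P ε fun i ω => -(x i ^ 2)⁻¹ * (X i ω - x i) := by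
    refine hX.const_mul (A := (b ^ 2)⁻¹) fun i => ?_
    rw [abs_neg, abs_inv, abs_of_nonneg (sq_nonneg _)]
    exact inv_anti₀ (pow_pos hb 2) (pow_le_pow_left₀ hb.le (hbx i) 2)
  have hmX : ∀ i, Measurable (X i) := fun i => by
    simpa using (hX.measurable i).add_const (x i)
  have h2 : SmallError P ε fun i ω => (x i ^ 2 * X i ω)⁻¹ * (X i ω - x i) ^ 2 := by
    refine hX.of_abs_le_sq (A := (b ^ 2 * b)⁻¹)
      (fun i => ((hmX i).const_mul _).inv.mul ((hX.measurable i).pow_const 2)) fun i ω => ?_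
    rw [abs_mul, abs_of_nonneg (sq_nonneg (X i ω - x i)), abs_inv,
      abs_of_pos (mul_pos (pow_pos (hx i) 2) (hX0 i ω))]
    refine mul_le_mul_of_nonneg_right (inv_anti₀ (by positivity) ?_) (sq_nonneg _)
    exact mul_le_mul (pow_le_pow_left₀ hb.le (hbx i) 2) (hbX i ω) hb.le (sq_nonneg _)
  refine (h1.add h2).congr fun i ω => ?_
  have := (hx i).ne'
  have := (hX0 i ω).ne'
  field_simp
  ring

end SmallError

end SmallError

/-! ### Empirical means of independent particles -/

/-- The average of `f` over the particle population `y`. -/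
noncomputable def empMean {Θ : Type*} {N : ℕ} (y : Fin N → Θ) (f : Θ → ℝ) : ℝ :=
  1 / (N : ℝ) * ∑ i, f (y i)

section EmpMean

variable {Θ : Type*} {N : ℕ}

theorem empMean_add (y : Fin N → Θ) (f g : Θ → ℝ) :
    empMean y (fun x => f x + g x) = empMean y f + empMean y g := by
  simp only [empMean, Finset.sum_add_distrib, mul_add]

theorem empMean_const_mul (y : Fin N → Θ) (a : ℝ) (f : Θ → ℝ) :
    empMean y (fun x => a * f x) = a * empMean y f := by
  simp only [empMean, ← Finset.mul_sum]
  ring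

theorem empMean_sum {κ : Type*} (y : Fin N → Θ) (s : Finset κ) (f : κ → Θ → ℝ) :
    empMean y (fun x => ∑ k ∈ s, f k x) = ∑ k ∈ s, empMean y (f k) := by
  simp only [empMean]
  rw [Finset.sum_comm, Finset.mul_sum]

theorem empMean_le [NeZero N] (y : Fin N → Θ) {f : Θ → ℝ} {c : ℝ} (hf : ∀ x, f x ≤ c) :
    empMean y f ≤ c := by
  have hN : 0 < (N : ℝ) := by exact_mod_cast Nat.pos_of_ne_zero (NeZero.ne N)
  have : ∑ i, f (y i) ≤ N * c := by
    simpa using Finset.sum_le_sum fun i (_ : i ∈ Finset.univ) => hf (y i)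
  rw [empMean, one_div, inv_mul_le_iff₀ hN]
  exact this

theorem le_empMean [NeZero N] (y : Fin N → Θ) {f : Θ → ℝ} {c : ℝ} (hf : ∀ x, c ≤ f x) :
    c ≤ empMean y f := by
  have h := empMean_le y (f := fun x => -1 * f x) (c := -c) fun x => by linarith [hf x]
  rw [empMean_const_mul] at h
  linarith

theorem abs_empMean_le [NeZero N] (y : Fin N → Θ) {f : Θ → ℝ} {c : ℝ} (hf : ∀ x, |f x| ≤ c) :
    |empMean y f| ≤ c :=
  abs_le.2 ⟨le_empMean y fun x => (abs_le.1 (hf x)).1, empMean_le y fun x => (abs_le.1 (hf x)).2⟩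

variable [MeasurableSpace Θ]

theorem measurable_empMean {f : Θ → ℝ} (hf : Measurable f) :
    Measurable fun y : Fin N → Θ => empMean y f := by
  unfold empMean
  fun_prop

theorem integral_pi_empMean [NeZero N] (ν : Measure Θ) [IsProbabilityMeasure ν] {f : Θ → ℝ}
    (hf : Measurable f) {c : ℝ} (hc : ∀ x, |f x| ≤ c) :
    ∫ y : Fin N → Θ, empMean y f ∂(Measure.pi fun _ => ν) = ∫ x, f x ∂ν := by
  have hN : (N : ℝ) ≠ 0 := by exact_mod_cast NeZero.ne N
  simp only [empMean]
  rw [integral_const_mul, integral_finsetSum]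
  · have : ∀ i : Fin N, ∫ y : Fin N → Θ, f (y i) ∂(Measure.pi fun _ => ν) = ∫ x, f x ∂ν :=
      fun i => integral_comp_eval (μ := fun _ : Fin N => ν) hf.aestronglyMeasurable
    simp only [this, Finset.sum_const, Finset.card_univ, Fintype.card_fin, nsmul_eq_mul]
    field_simp
  · exact fun i _ => integrable_of_abs_le (hf.comp (measurable_pi_apply i)) fun y => hc (y i)

theorem integral_pi_empMean_sub_sq_le [NeZero N] (ν : Measure Θ) [IsProbabilityMeasure ν]
    {f : Θ → ℝ} (hf : Measurable f) {c : ℝ} (hc : ∀ x, |f x| ≤ c) :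
    ∫ y : Fin N → Θ, (empMean y f - ∫ x, f x ∂ν) ^ 2 ∂(Measure.pi fun _ => ν) ≤
      c ^ 2 * (1 / (N : ℝ)) := by
  have hN : 0 < (N : ℝ) := by exact_mod_cast Nat.pos_of_ne_zero (NeZero.ne N)
  have hL : MemLp f 2 ν :=
    MemLp.of_bound hf.aestronglyMeasurable c (Filter.Eventually.of_forall hc)
  have h1 := variance_eq_integral
    (measurable_empMean (N := N) hf).aemeasurable (μ := Measure.pi fun _ => ν)
  rw [integral_pi_empMean ν hf hc] at h1
  rw [← h1]
  have h2 := variance_sum_pi (μ := fun _ : Fin N => ν) (X := fun _ => f) fun _ => hL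
  have h3 : (fun y : Fin N → Θ => empMean y f) =
      fun y => 1 / (N : ℝ) * (∑ i : Fin N, fun ω : Fin N → Θ => f (ω i)) y := by
    funext y
    simp [empMean]
  have h4 : Var[f; ν] ≤ c ^ 2 := by
    refine (variance_le_expectation_sq hf.aestronglyMeasurable).trans ?_
    refine (le_abs_self _).trans (abs_integral_le_of_abs_le fun x => ?_)
    simp only [Pi.pow_apply, abs_pow]
    exact pow_le_pow_left₀ (abs_nonneg _) (hc x) 2
  rw [h3, variance_const_mul, h2]
  simp only [Finset.sum_const, Finset.card_univ, Fintype.card_fin, nsmul_eq_mul]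
  calc (1 / (N : ℝ)) ^ 2 * (N * Var[f; ν]) = Var[f; ν] * (1 / (N : ℝ)) := by field_simp
    _ ≤ _ := mul_le_mul_of_nonneg_right h4 (by positivity)

end EmpMean

/-! ### Conditional structure of the particle law -/

theorem integral_bind_kernel {α γ : Type*} [MeasurableSpace α] [MeasurableSpace γ]
    (μ : Measure α) [IsProbabilityMeasure μ] (κ : Kernel α γ) [IsMarkovKernel κ] {f : γ → ℝ}
    (hf : Measurable f) {c : ℝ} (hc : ∀ x, |f x| ≤ c) :
    ∫ y, f y ∂(μ.bind κ) = ∫ x, ∫ y, f y ∂(κ x) ∂μ := by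
  rw [← Measure.snd_compProd μ κ, Measure.snd,
    integral_map measurable_snd.aemeasurable hf.aestronglyMeasurable,
    Measure.integral_compProd]
  exact integrable_of_abs_le (hf.comp measurable_snd) fun x => hc x.2

namespace Sampler

variable {Θ : Type*} [MeasurableSpace Θ] (S : Sampler Θ) {N : ℕ}

/-- `Ẑ_t` reads only iterations before `t`. This lets it be treated as part of the past when
conditioning in `integral_law_step`. -/
theorem Zhat_congr {θ θ' : ℕ → Fin N → Θ} {t : ℕ}
    (h : ∀ s ∈ Finset.Icc 1 (t - 1), θ s = θ' s) : S.Zhat θ t = S.Zhat θ' t := by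
  induction t using Nat.strong_induction_on with
  | _ t ih =>
    by_cases ht : t ≤ 1
    · rw [Zhat, Zhat, if_pos ht, if_pos ht]
    · rw [S.Zhat_of_two_le _ (by omega), S.Zhat_of_two_le _ (by omega)]
      refine congrArg _ (Finset.sum_congr rfl fun t' ht' => ?_)
      rw [h t' ht']
      refine congrArg _ (Finset.sum_congr rfl fun i _ => ?_)
      unfold weight
      refine congrArg _ (congrArg _ (Finset.sum_congr rfl fun s hs => ?_))
      have hs' := Finset.mem_Icc.1 hs
      rw [ih s (by omega) fun r hr => h r ?_]
      have := Finset.mem_Icc.1 hr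
      exact Finset.mem_Icc.2 ⟨this.1, by omega⟩

theorem weight_congr {θ θ' : ℕ → Fin N → Θ} {t : ℕ}
    (h : ∀ s ∈ Finset.Icc 1 (t - 1), θ s = θ' s) (x : Θ) :
    S.weight θ t x = S.weight θ' t x := by
  unfold weight
  refine congrArg _ (congrArg _ (Finset.sum_congr rfl fun s hs => ?_))
  rw [S.Zhat_congr fun r hr => h r ?_]
  have := Finset.mem_Icc.1 hr
  have := Finset.mem_Icc.1 hs
  exact Finset.mem_Icc.2 ⟨by omega, by omega⟩

theorem ensemble_congr {θ θ' : ℕ → Fin N → Θ} {t : ℕ}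
    (h : ∀ s ∈ Finset.Icc 1 (t - 1), θ s = θ' s) : S.ensemble θ t = S.ensemble θ' t := by
  unfold ensemble
  refine Finset.sum_congr rfl fun t' ht' => Finset.sum_congr rfl fun i _ => ?_
  rw [h t' ht', S.weight_congr h, S.Zhat_congr h]

theorem nextLaw_congr {θ θ' : ℕ → Fin N → Θ} {t : ℕ}
    (h : ∀ s ∈ Finset.Icc 1 (t - 1), θ s = θ' s) : S.nextLaw θ t = S.nextLaw θ' t := by
  unfold nextLaw
  rw [S.ensemble_congr h]

/-- The self-normalized form: a weighted average over all earlier particles, times `Ẑ_t⁻¹`. Each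
factor is then estimated separately. -/
theorem integral_ensemble [NeZero N] (θ : ℕ → Fin N → Θ) {t : ℕ} (ht : 2 ≤ t) {g : Θ → ℝ}
    (hg : Measurable g) :
    ∫ x, g x ∂(S.ensemble θ t) =
      (1 / ((t : ℝ) - 1) * ∑ t' ∈ Finset.Icc 1 (t - 1),
        empMean (θ t') fun x => g x * S.weight θ t x) * (S.Zhat θ t)⁻¹ := by
  have h1 : 0 < (t : ℝ) - 1 := by
    have : (1 : ℝ) < t := by exact_mod_cast (by omega : 1 < t)
    linarith
  have h2 : 0 < (N : ℝ) := by exact_mod_cast Nat.pos_of_ne_zero (NeZero.ne N)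
  have hw : ∀ t' i, 0 ≤ S.weight θ t (θ t' i) / S.Zhat θ t / (((t : ℝ) - 1) * N) := fun t' i =>
    div_nonneg (div_nonneg (S.weight_pos θ ht _).le (S.Zhat_pos θ t).le) (mul_pos h1 h2).le
  have hd : ∀ (a : ℝ) (x : Θ), Integrable g (ENNReal.ofReal a • Measure.dirac x) := fun a x =>
    (integrable_dirac' hg.stronglyMeasurable (by simp)).smul_measure ENNReal.ofReal_ne_top
  unfold ensemble
  rw [integral_finsetSum_measure fun t' _ => integrable_finsetSum_measure.2 fun i _ => hd _ _]
  simp_rw [integral_finsetSum_measure fun i (_ : i ∈ Finset.univ) => hd _ _,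
    integral_smul_measure, integral_dirac' g _ hg.stronglyMeasurable, smul_eq_mul,
    ENNReal.toReal_ofReal (hw _ _), empMean, Finset.mul_sum, Finset.sum_mul]
  refine Finset.sum_congr rfl fun t' _ => Finset.sum_congr rfl fun i _ => ?_
  have := (S.Zhat_pos θ t).ne'
  field_simp

theorem measurable_shift :
    Measurable (fun x s => x (s - 1) : (ℕ → Fin N → Θ) → ℕ → Fin N → Θ) := by
  fun_prop

instance [NeZero N] : IsProbabilityMeasure (S.law N) :=
  Measure.isProbabilityMeasure_map measurable_shift.aemeasurable

theorem map_eval_one_law [NeZero N] :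
    (S.law N).map (fun θ => θ 1) = Measure.pi fun _ => S.prior := by
  rw [law, Measure.map_map (by fun_prop) measurable_shift]
  have : (fun θ : ℕ → Fin N → Θ => θ 1) ∘
      (fun x s => x (s - 1) : (ℕ → Fin N → Θ) → ℕ → Fin N → Θ) =
      (fun h : (i : Finset.Iic 0) → Fin N → Θ => h ⟨0, by simp⟩) ∘ Preorder.frestrictLe 0 := rfl
  rw [this, ← Measure.map_map (by fun_prop) (by fun_prop), Kernel.trajMeasure,
    Measure.map_comp _ _ (by fun_prop), Kernel.traj_map_frestrictLe, Kernel.partialTraj_self,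
    Measure.id_comp, Measure.map_map (by fun_prop) (by fun_prop)]
  exact Measure.map_id

theorem integral_law_one [NeZero N] {G : (Fin N → Θ) → ℝ} (hG : Measurable G) :
    ∫ θ, G (θ 1) ∂(S.law N) = ∫ y, G y ∂(Measure.pi fun _ => S.prior) := by
  rw [← S.map_eval_one_law, integral_map (measurable_pi_apply 1).aemeasurable hG.aestronglyMeasurable]

theorem measurable_renumber (n : ℕ) :
    Measurable (renumber n : ((i : Finset.Iic n) → Fin N → Θ) → ℕ → Fin N → Θ) :=
  measurable_pi_lambda _ fun _ => measurable_pi_apply _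

/-- The particles of iteration `t` follow `nextLaw`, conditionally on the past. -/
theorem integral_law_step [NeZero N] {t : ℕ} (ht : 2 ≤ t)
    {G : (ℕ → Fin N → Θ) → (Fin N → Θ) → ℝ} (hG : Measurable (Function.uncurry G)) {c : ℝ}
    (hc : ∀ θ y, |G θ y| ≤ c)
    (hpast : ∀ θ θ', (∀ s ∈ Finset.Icc 1 (t - 1), θ s = θ' s) → G θ = G θ') :
    ∫ θ, G θ (θ t) ∂(S.law N) = ∫ θ, ∫ y, G θ y ∂(S.nextLaw θ t) ∂(S.law N) := by
  obtain ⟨n, rfl⟩ : ∃ n, t = n + 2 := ⟨t - 2, by omega⟩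
  have hp : ∀ θ : ℕ → Fin N → Θ, IsProbabilityMeasure (S.nextLaw θ (n + 2)) := fun θ =>
    S.isProbabilityMeasure_nextLaw θ ht
  let κ : Kernel (ℕ → Fin N → Θ) (Fin N → Θ) :=
    ⟨fun θ => S.nextLaw θ (n + 2), S.measurable_nextLaw ht⟩
  have : IsMarkovKernel κ := ⟨hp⟩
  have hmeas : AEStronglyMeasurable (fun θ => ∫ y, G θ y ∂(S.nextLaw θ (n + 2)))
      (S.law N) :=
    (StronglyMeasurable.integral_kernel_prod_right (κ := κ)
      hG.stronglyMeasurable).aestronglyMeasurable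
  have hagree : ∀ (x : ℕ → Fin N → Θ), ∀ s ∈ Finset.Icc 1 (n + 2 - 1),
      (fun s => x (s - 1)) s = renumber n (Preorder.frestrictLe n x) s := fun x s hs => by
    have := Finset.mem_Icc.1 hs
    simp only [renumber, Preorder.frestrictLe_apply]
    rw [min_eq_left (by omega)]
  have hG' : Measurable fun p : ((i : Finset.Iic n) → Fin N → Θ) × (Fin N → Θ) =>
      G (renumber n p.1) p.2 :=
    hG.comp (((measurable_renumber n).comp measurable_fst).prodMk measurable_snd)
  have hmeas' : StronglyMeasurable fun h : (i : Finset.Iic n) → Fin N → Θ =>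
      ∫ y, G (renumber n h) y ∂(S.step N n h) :=
    StronglyMeasurable.integral_kernel_prod_right (κ := S.step N n)
      (f := fun h y => G (renumber n h) y) hG'.stronglyMeasurable
  rw [law] at hmeas ⊢
  have hdiag : Measurable fun θ : ℕ → Fin N → Θ => G θ (θ (n + 2)) :=
    hG.comp (measurable_id.prodMk (measurable_pi_apply (n + 2)))
  rw [integral_map measurable_shift.aemeasurable hdiag.aestronglyMeasurable,
    integral_map measurable_shift.aemeasurable hmeas]
  -- Only entries `1, …, n + 1` of the shifted trajectory matter, so it may be replaced by the
  -- renumbered finite history on which `step` acts.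
  simp_rw [fun x => hpast _ _ (hagree x), fun x => S.nextLaw_congr (hagree x)]
  set Q := Kernel.trajMeasure (X := fun _ => Fin N → Θ) (Measure.pi fun _ => S.prior) (S.step N)
  have hpair : Measurable fun x : ℕ → Fin N → Θ =>
      ((Preorder.frestrictLe n x : (i : Finset.Iic n) → Fin N → Θ), x (n + 1)) := by
    fun_prop
  calc ∫ x, G (renumber n (Preorder.frestrictLe n x)) (x (n + 2 - 1)) ∂Q
      = ∫ p, G (renumber n p.1) p.2
          ∂(Q.map fun x => (Preorder.frestrictLe n x, x (n + 1))) :=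
        (integral_map hpair.aemeasurable hG'.aestronglyMeasurable).symm
    _ = ∫ p, G (renumber n p.1) p.2 ∂(Q.map (Preorder.frestrictLe n) ⊗ₘ S.step N n) := by
        rw [Kernel.map_frestrictLe_trajMeasure_compProd_eq_map_trajMeasure]
    _ = ∫ h, ∫ y, G (renumber n h) y ∂(S.step N n h) ∂(Q.map (Preorder.frestrictLe n)) := by
        have : IsProbabilityMeasure (Q.map (Preorder.frestrictLe n)) :=
          Measure.isProbabilityMeasure_map (by fun_prop)
        exact Measure.integral_compProd (integrable_of_abs_le hG' fun p => hc _ _)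
    _ = _ := integral_map (by fun_prop) hmeas'.aestronglyMeasurable

end Sampler

/-! ### Deterministic bounds on densities, weights and estimates -/

theorem avg_le {t : ℕ} (ht : 2 ≤ t) {f : ℕ → ℝ} {b : ℝ}
    (hf : ∀ s ∈ Finset.Icc 1 (t - 1), f s ≤ b) :
    1 / ((t : ℝ) - 1) * ∑ s ∈ Finset.Icc 1 (t - 1), f s ≤ b := by
  have h1 : 0 < (t : ℝ) - 1 := by
    have : (1 : ℝ) < t := by exact_mod_cast (by omega : 1 < t)
    linarith
  rw [one_div, inv_mul_le_iff₀ h1]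
  refine (Finset.sum_le_card_nsmul _ _ _ hf).trans_eq ?_
  rw [Nat.card_Icc, nsmul_eq_mul, Nat.add_sub_cancel, Nat.cast_sub (by omega), Nat.cast_one]

theorem le_avg {t : ℕ} (ht : 2 ≤ t) {f : ℕ → ℝ} {a : ℝ}
    (hf : ∀ s ∈ Finset.Icc 1 (t - 1), a ≤ f s) :
    a ≤ 1 / ((t : ℝ) - 1) * ∑ s ∈ Finset.Icc 1 (t - 1), f s := by
  have h := avg_le ht (f := fun s => -f s) (b := -a) fun s hs => neg_le_neg (hf s hs)
  rw [Finset.sum_neg_distrib, mul_neg] at h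
  linarith

/-- Cauchy–Schwarz, with the remaining factor `1/(t-1) ≤ 1` dropped. -/
theorem avg_sq_le {t : ℕ} (ht : 2 ≤ t) (f : ℕ → ℝ) :
    (1 / ((t : ℝ) - 1) * ∑ s ∈ Finset.Icc 1 (t - 1), f s) ^ 2 ≤
      ∑ s ∈ Finset.Icc 1 (t - 1), f s ^ 2 := by
  have h1 : 1 ≤ (t : ℝ) - 1 := by
    have : (2 : ℝ) ≤ t := by exact_mod_cast ht
    linarith
  have h := sq_sum_le_card_mul_sum_sq (s := Finset.Icc 1 (t - 1)) (f := f)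
  rw [Nat.card_Icc, Nat.add_sub_cancel, Nat.cast_sub (by omega), Nat.cast_one] at h
  have h0 : 0 ≤ ∑ s ∈ Finset.Icc 1 (t - 1), f s ^ 2 := Finset.sum_nonneg fun s _ => sq_nonneg _
  rw [mul_pow, div_pow, one_pow, one_div, inv_mul_le_iff₀ (by positivity)]
  nlinarith

namespace Sampler

variable {Θ : Type*} [MeasurableSpace Θ] (S : Sampler Θ) {N : ℕ}

/-- The density `(t-1)⁻¹ ∑_{s<t} L^{β_s} / z_s` with respect to the prior of the mixture of the
first `t - 1` targets, computed with the normalizing constants `z`. -/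
noncomputable def mixtureDensity (t : ℕ) (z : ℕ → ℝ) (x : Θ) : ℝ :=
  1 / ((t : ℝ) - 1) * ∑ s ∈ Finset.Icc 1 (t - 1), S.L x ^ S.β s * (z s)⁻¹

theorem weight_eq_div_mixtureDensity (θ : ℕ → Fin N → Θ) (t : ℕ) (x : Θ) :
    S.weight θ t x = S.L x ^ S.β t / S.mixtureDensity t (S.Zhat θ) x := rfl

theorem measurable_rpow (s : ℕ) : Measurable fun x => S.L x ^ S.β s :=
  S.measurable_L.pow_const _

theorem measurable_mixtureDensity (t : ℕ) (z : ℕ → ℝ) : Measurable (S.mixtureDensity t z) :=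
  measurable_const.mul <| Finset.measurable_fun_sum _ fun s _ =>
    (S.measurable_rpow s).mul measurable_const

/-- The annealed likelihoods are bounded by `B` and bounded below by `B⁻¹`, and the MCMC kernels
leave the targets invariant. -/
structure Bounds (T : ℕ) (B : ℝ) : Prop where
  one_le : 1 ≤ B
  β_one : S.β 1 = 0
  invariant : ∀ t ∈ Finset.Icc 1 T, Kernel.Invariant (S.K t) (S.target t)
  le : ∀ t ∈ Finset.Icc 1 T, ∀ x, S.L x ^ S.β t ≤ B
  inv_le : ∀ t ∈ Finset.Icc 1 T, ∀ x, B⁻¹ ≤ S.L x ^ S.β t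

namespace Bounds

variable {S} {T : ℕ} {B : ℝ} (h : S.Bounds T B)

include h

theorem pos : 0 < B := one_pos.trans_le h.one_le

theorem abs_rpow_le {t : ℕ} (ht : t ∈ Finset.Icc 1 T) (x : Θ) : |S.L x ^ S.β t| ≤ B := by
  rw [abs_of_pos (Real.rpow_pos_of_pos (S.L_pos x) _)]
  exact h.le t ht x

theorem integrable_rpow {t : ℕ} (ht : t ∈ Finset.Icc 1 T) :
    Integrable (fun x => S.L x ^ S.β t) S.prior :=
  integrable_of_abs_le (S.measurable_rpow t) (h.abs_rpow_le ht)

theorem Z_le {t : ℕ} (ht : t ∈ Finset.Icc 1 T) : S.Z t ≤ B := by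
  simpa [Z] using integral_mono (h.integrable_rpow ht) (integrable_const B) (h.le t ht)

theorem inv_le_Z {t : ℕ} (ht : t ∈ Finset.Icc 1 T) : B⁻¹ ≤ S.Z t := by
  simpa [Z] using integral_mono (integrable_const B⁻¹) (h.integrable_rpow ht) (h.inv_le t ht)

theorem Z_pos {t : ℕ} (ht : t ∈ Finset.Icc 1 T) : 0 < S.Z t :=
  (inv_pos.2 h.pos).trans_le (h.inv_le_Z ht)

theorem integral_target {t : ℕ} (ht : t ∈ Finset.Icc 1 T) (f : Θ → ℝ) :
    ∫ x, f x ∂(S.target t) = ∫ x, f x * (S.L x ^ S.β t * (S.Z t)⁻¹) ∂S.prior := by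
  have hd : Measurable fun x => ENNReal.ofReal (S.L x ^ S.β t / S.Z t) :=
    ENNReal.measurable_ofReal.comp ((S.measurable_rpow t).div_const _)
  rw [target, integral_withDensity_eq_integral_toReal_smul hd
    (Filter.Eventually.of_forall fun x => ENNReal.ofReal_lt_top)]
  refine integral_congr_ae (Filter.Eventually.of_forall fun x => ?_)
  dsimp only
  rw [ENNReal.toReal_ofReal
    (div_nonneg (Real.rpow_nonneg (S.L_pos x).le _) (h.Z_pos ht).le), smul_eq_mul, mul_comm,
    div_eq_mul_inv]

theorem isProbabilityMeasure_target {t : ℕ} (ht : t ∈ Finset.Icc 1 T) :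
    IsProbabilityMeasure (S.target t) := by
  constructor
  rw [target, withDensity_apply _ MeasurableSet.univ, Measure.restrict_univ,
    ← ofReal_integral_eq_lintegral_ofReal ((h.integrable_rpow ht).div_const _)
      (Filter.Eventually.of_forall fun x =>
        div_nonneg (Real.rpow_nonneg (S.L_pos x).le _) (h.Z_pos ht).le),
    integral_div, ← Z, div_self (h.Z_pos ht).ne', ENNReal.ofReal_one]

theorem target_one : S.target 1 = S.prior := by
  have : S.Z 1 = 1 := by simp [Z, h.β_one]
  simp [target, h.β_one, this]

/-- The constants `z` are left arbitrary because both the exact `Z` and the random `Ẑ` are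
substituted. -/
theorem mixtureDensity_mem {F : ℝ} (hF : 0 < F) {t : ℕ} (ht : 2 ≤ t) (htT : t ≤ T) {z : ℕ → ℝ}
    (hz : ∀ s ∈ Finset.Icc 1 (t - 1), F⁻¹ ≤ z s ∧ z s ≤ F) (x : Θ) :
    (B * F)⁻¹ ≤ S.mixtureDensity t z x ∧ S.mixtureDensity t z x ≤ B * F := by
  have hmem : ∀ s ∈ Finset.Icc 1 (t - 1), s ∈ Finset.Icc 1 T := fun s hs => by
    have := Finset.mem_Icc.1 hs
    exact Finset.mem_Icc.2 ⟨this.1, by omega⟩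
  constructor
  · refine le_avg ht fun s hs => ?_
    rw [mul_inv]
    exact mul_le_mul (h.inv_le s (hmem s hs) x)
      (inv_anti₀ ((inv_pos.2 hF).trans_le (hz s hs).1) (hz s hs).2) (inv_pos.2 hF).le
      (Real.rpow_nonneg (S.L_pos x).le _)
  · refine avg_le ht fun s hs => ?_
    exact mul_le_mul (h.le s (hmem s hs) x) (inv_le_of_inv_le₀ hF (hz s hs).1)
      (inv_nonneg.2 ((inv_pos.2 hF).trans_le (hz s hs).1).le) h.pos.le

theorem weight_mem {F : ℝ} (hF : 0 < F) {t : ℕ} (ht : 2 ≤ t) (htT : t ≤ T)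
    {θ : ℕ → Fin N → Θ}
    (hz : ∀ s ∈ Finset.Icc 1 (t - 1), F⁻¹ ≤ S.Zhat θ s ∧ S.Zhat θ s ≤ F) (x : Θ) :
    (B ^ 2 * F)⁻¹ ≤ S.weight θ t x ∧ S.weight θ t x ≤ B ^ 2 * F := by
  have hB := h.pos
  have htm : t ∈ Finset.Icc 1 T := Finset.mem_Icc.2 ⟨by omega, htT⟩
  obtain ⟨h1, h2⟩ := h.mixtureDensity_mem hF ht htT hz x
  have h0 : 0 < S.mixtureDensity t (S.Zhat θ) x :=
    (inv_pos.2 (mul_pos hB hF)).trans_le h1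
  rw [weight_eq_div_mixtureDensity, div_eq_mul_inv,
    show B ^ 2 * F = B * (B * F) by ring]
  constructor
  · rw [mul_inv]
    exact mul_le_mul (h.inv_le t htm x) (inv_anti₀ h0 h2) (by positivity)
      (Real.rpow_nonneg (S.L_pos x).le _)
  · exact mul_le_mul (h.le t htm x) (inv_le_of_inv_le₀ (by positivity) h1)
      (inv_nonneg.2 h0.le) hB.le

theorem Zhat_mem_pow [NeZero N] {t : ℕ} (ht : t ∈ Finset.Icc 1 T) (θ : ℕ → Fin N → Θ) :
    (B ^ (2 * t))⁻¹ ≤ S.Zhat θ t ∧ S.Zhat θ t ≤ B ^ (2 * t) := by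
  have hB := h.pos
  induction t using Nat.strong_induction_on with
  | _ t ih =>
    obtain ⟨ht1, htT⟩ := Finset.mem_Icc.1 ht
    rcases ht1.eq_or_lt with rfl | ht2
    · rw [S.Zhat_one]
      have : 1 ≤ B ^ (2 * 1) := one_le_pow₀ h.one_le
      exact ⟨inv_le_one_of_one_le₀ this, this⟩
    · have hz : ∀ s ∈ Finset.Icc 1 (t - 1),
          (B ^ (2 * (t - 1)))⁻¹ ≤ S.Zhat θ s ∧ S.Zhat θ s ≤ B ^ (2 * (t - 1)) := fun s hs => by
        have hs' := Finset.mem_Icc.1 hs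
        obtain ⟨h1, h2⟩ := ih s (by omega) (Finset.mem_Icc.2 ⟨hs'.1, by omega⟩)
        have hle : B ^ (2 * s) ≤ B ^ (2 * (t - 1)) := pow_le_pow_right₀ h.one_le (by omega)
        exact ⟨(inv_anti₀ (by positivity) hle).trans h1, h2.trans hle⟩
      -- Each iteration costs a factor `B²`: one `B` from the numerator of the weight and one from
      -- its denominator.
      have hw := h.weight_mem (by positivity) ht2 htT hz
      rw [← pow_add, show 2 + 2 * (t - 1) = 2 * t by omega] at hw
      rw [S.Zhat_of_two_le θ ht2]
      exact ⟨le_avg ht2 fun s _ => le_empMean (θ s) fun x => (hw x).1,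
        avg_le ht2 fun s _ => empMean_le (θ s) fun x => (hw x).2⟩

theorem Zhat_mem [NeZero N] {t : ℕ} (ht : t ∈ Finset.Icc 1 T) (θ : ℕ → Fin N → Θ) :
    (B ^ (2 * T))⁻¹ ≤ S.Zhat θ t ∧ S.Zhat θ t ≤ B ^ (2 * T) := by
  have hB := h.pos
  obtain ⟨h1, h2⟩ := h.Zhat_mem_pow ht θ
  have hle : B ^ (2 * t) ≤ B ^ (2 * T) :=
    pow_le_pow_right₀ h.one_le (by have := Finset.mem_Icc.1 ht; omega)
  exact ⟨(inv_anti₀ (by positivity) hle).trans h1, h2.trans hle⟩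

theorem Z_mem {t : ℕ} (ht : t ∈ Finset.Icc 1 T) :
    (B ^ (2 * T))⁻¹ ≤ S.Z t ∧ S.Z t ≤ B ^ (2 * T) := by
  have hle : B ≤ B ^ (2 * T) :=
    le_self_pow₀ h.one_le (by have := Finset.mem_Icc.1 ht; omega)
  exact ⟨(inv_anti₀ h.pos hle).trans (h.inv_le_Z ht), (h.Z_le ht).trans hle⟩

end Bounds

end Sampler

/-! ### Propagation of small errors through the iterations -/

/-- A family of functions that are measurable and uniformly bounded. -/
def UniformlyBounded {ι : Type*} {Θ : ι → Type*} [∀ i, MeasurableSpace (Θ i)]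
    (f : ∀ i, Θ i → ℝ) : Prop :=
  (∀ i, Measurable (f i)) ∧ ∃ c, ∀ i x, |f i x| ≤ c

theorem UniformlyBounded.mul {ι : Type*} {Θ : ι → Type*} [∀ i, MeasurableSpace (Θ i)]
    {f g : ∀ i, Θ i → ℝ} (hf : UniformlyBounded f) (hg : UniformlyBounded g) :
    UniformlyBounded fun i x => f i x * g i x := by
  obtain ⟨hfm, c, hc⟩ := hf
  obtain ⟨hgm, d, hd⟩ := hg
  refine ⟨fun i => (hfm i).mul (hgm i), c * d, fun i x => ?_⟩
  rw [abs_mul]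
  exact mul_le_mul (hc i x) (hd i x) (abs_nonneg _) ((abs_nonneg _).trans (hc i x))

/-- Used with `q` the exact mixture density and `r` its perturbation by the errors of the inverse
constants. -/
theorem inv_linearization {g q r : ℝ} (hq : q ≠ 0) (hqr : q + r ≠ 0) :
    g / (q + r) = g / q - r * (g / q ^ 2) + g * r ^ 2 / (q ^ 2 * (q + r)) := by
  field_simp
  ring

namespace Sampler

section Family

variable {ι : Type*} {Θ : ι → Type*} [∀ i, MeasurableSpace (Θ i)] {S : ∀ i, Sampler (Θ i)}
  {N : ι → ℕ} [∀ i, NeZero (N i)] {T : ℕ} {B : ℝ}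

/-- The empirical means of the particles of iteration `t` approximate the target, up to small
errors. -/
def PopulationConsistent (S : ∀ i, Sampler (Θ i)) (N : ι → ℕ) [∀ i, NeZero (N i)] (t : ℕ) :
    Prop :=
  ∀ f : ∀ i, Θ i → ℝ, UniformlyBounded f →
    SmallError (fun i => (S i).law (N i)) (fun i => 1 / (N i : ℝ))
      fun i θ => empMean (θ t) (f i) - ∫ x, f i x ∂((S i).target t)

/-- The estimate `Ẑ_t` approximates `Z_t`, up to a small error. -/
def ConstantConsistent (S : ∀ i, Sampler (Θ i)) (N : ι → ℕ) [∀ i, NeZero (N i)] (t : ℕ) :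
    Prop :=
  SmallError (fun i => (S i).law (N i)) (fun i => 1 / (N i : ℝ))
    fun i θ => (S i).Zhat θ t - (S i).Z t

theorem ConstantConsistent.inv (hS : ∀ i, (S i).Bounds T B) {t : ℕ} (ht : t ∈ Finset.Icc 1 T)
    (h : ConstantConsistent S N t) :
    SmallError (fun i => (S i).law (N i)) (fun i => 1 / (N i : ℝ))
      fun i θ => ((S i).Zhat θ t)⁻¹ - ((S i).Z t)⁻¹ := by
  -- Positivity of `B` is read off from any one instance; an empty family is vacuous.
  rcases isEmpty_or_nonempty ι with hι | ⟨⟨i₀⟩⟩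
  · exact ⟨fun i => hι.elim i, ⟨0, fun i => hι.elim i⟩, ⟨0, fun i => hι.elim i⟩,
      ⟨0, fun i => hι.elim i⟩⟩
  have hB := (hS i₀).pos
  exact SmallError.inv_sub_inv (b := (B ^ (2 * T))⁻¹) (by positivity)
    (fun i => ((hS i).Z_mem ht).1) (fun i θ => ((hS i).Zhat_mem ht θ).1) h

theorem measurable_empMean_weight {Θ : Type*} [MeasurableSpace Θ] (S : Sampler Θ) {N : ℕ}
    (t s : ℕ) {f : Θ → ℝ} (hf : Measurable f) :
    Measurable fun θ : ℕ → Fin N → Θ => empMean (θ s) fun x => f x * S.weight θ t x := by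
  unfold empMean
  refine measurable_const.mul (Finset.measurable_fun_sum _ fun i _ => Measurable.mul ?_ ?_)
  · exact hf.comp (by fun_prop)
  · exact S.measurable_weight (by fun_prop) fun s _ => S.measurable_Zhat s

/-- Averaging over the earlier targets is integration against their mixture. For `f = g / q` with
`q` its density, `q` cancels. -/
theorem Bounds.sum_integral_target {Θ : Type*} [MeasurableSpace Θ] {S : Sampler Θ}
    (h : S.Bounds T B) {t : ℕ} (htT : t ≤ T) {f : Θ → ℝ} (hf : Measurable f) {c : ℝ}
    (hc : ∀ x, |f x| ≤ c) :
    1 / ((t : ℝ) - 1) * ∑ s ∈ Finset.Icc 1 (t - 1), ∫ x, f x ∂(S.target s) =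
      ∫ x, f x * S.mixtureDensity t S.Z x ∂S.prior := by
  have hmem : ∀ s ∈ Finset.Icc 1 (t - 1), s ∈ Finset.Icc 1 T := fun s hs => by
    have := Finset.mem_Icc.1 hs
    exact Finset.mem_Icc.2 ⟨this.1, by omega⟩
  have hint : ∀ s ∈ Finset.Icc 1 (t - 1),
      Integrable (fun x => f x * (S.L x ^ S.β s * (S.Z s)⁻¹)) S.prior := fun s hs =>
    ((h.integrable_rpow (hmem s hs)).mul_const _).bdd_mul hf.aestronglyMeasurable
      (Filter.Eventually.of_forall hc)
  rw [Finset.sum_congr rfl fun s hs => h.integral_target (hmem s hs) f,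
    ← integral_finsetSum _ hint, ← integral_const_mul]
  refine integral_congr_ae (Filter.Eventually.of_forall fun x => ?_)
  simp only [mixtureDensity, Finset.mul_sum]
  exact Finset.sum_congr rfl fun s _ => by ring

/-- The remainder of the linearization of the weights is quadratic in the errors of the inverse
normalizing constants. -/
theorem Bounds.abs_remainder_le {Θ : Type*} [MeasurableSpace Θ] {S : Sampler Θ}
    (h : S.Bounds T B) {N : ℕ} [NeZero N] {t : ℕ} (ht : 2 ≤ t) (htT : t ≤ T) {f : Θ → ℝ} {c : ℝ}
    (hc : ∀ x, |f x| ≤ c) (θ : ℕ → Fin N → Θ) (x : Θ) :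
    |f x * S.weight θ t x - (f x * (S.L x ^ S.β t / S.mixtureDensity t S.Z x) +
      -(1 / ((t : ℝ) - 1)) * ∑ s ∈ Finset.Icc 1 (t - 1), ((S.Zhat θ s)⁻¹ - (S.Z s)⁻¹) *
        (f x * (S.L x ^ S.β s * (S.L x ^ S.β t / S.mixtureDensity t S.Z x ^ 2))))| ≤
      c * (B * (B ^ 2 * (B * B ^ (2 * T)) ^ 3)) *
        ∑ s ∈ Finset.Icc 1 (t - 1), ((S.Zhat θ s)⁻¹ - (S.Z s)⁻¹) ^ 2 := by
  have hB := h.pos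
  have hc0 : 0 ≤ c := (abs_nonneg _).trans (hc x)
  have hmem : ∀ s ∈ Finset.Icc 1 (t - 1), s ∈ Finset.Icc 1 T := fun s hs => by
    have := Finset.mem_Icc.1 hs
    exact Finset.mem_Icc.2 ⟨this.1, by omega⟩
  have htm : t ∈ Finset.Icc 1 T := Finset.mem_Icc.2 ⟨by omega, htT⟩
  have hF : 0 < B ^ (2 * T) := by positivity
  set q := S.mixtureDensity t S.Z x with hq
  set a : ℕ → ℝ := fun s => (S.Zhat θ s)⁻¹ - (S.Z s)⁻¹ with ha
  set r := 1 / ((t : ℝ) - 1) * ∑ s ∈ Finset.Icc 1 (t - 1), S.L x ^ S.β s * a s with hr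
  have hqr : S.mixtureDensity t (S.Zhat θ) x = q + r := by
    rw [hq, hr, mixtureDensity, mixtureDensity, ← mul_add, ← Finset.sum_add_distrib]
    refine congrArg _ (Finset.sum_congr rfl fun s _ => ?_)
    rw [ha]
    ring
  have h1 := (h.mixtureDensity_mem hF ht htT (fun s hs => h.Z_mem (hmem s hs)) x).1
  have h2 := (h.mixtureDensity_mem hF ht htT (fun s hs => h.Zhat_mem (hmem s hs) θ) x).1
  rw [hqr] at h2
  rw [← hq] at h1
  have hD : 0 < (B * B ^ (2 * T))⁻¹ := by positivity
  have hq0 : 0 < q := hD.trans_le h1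
  have hqr0 : 0 < q + r := hD.trans_le h2
  have hlin : S.weight θ t x = S.L x ^ S.β t / (q + r) := by
    rw [weight_eq_div_mixtureDensity, hqr]
  have hsum : ∑ s ∈ Finset.Icc 1 (t - 1), a s *
      (f x * (S.L x ^ S.β s * (S.L x ^ S.β t / q ^ 2))) =
      (∑ s ∈ Finset.Icc 1 (t - 1), S.L x ^ S.β s * a s) * (f x * (S.L x ^ S.β t / q ^ 2)) := by
    rw [Finset.sum_mul]
    exact Finset.sum_congr rfl fun s _ => by ring
  have hrem : f x * S.weight θ t x - (f x * (S.L x ^ S.β t / q) +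
      -(1 / ((t : ℝ) - 1)) * ∑ s ∈ Finset.Icc 1 (t - 1), a s *
        (f x * (S.L x ^ S.β s * (S.L x ^ S.β t / q ^ 2)))) =
      f x * (S.L x ^ S.β t * (r ^ 2 * (q ^ 2 * (q + r))⁻¹)) := by
    rw [hsum, hlin, inv_linearization hq0.ne' hqr0.ne', hr]
    ring
  have hr2 : r ^ 2 ≤ B ^ 2 * ∑ s ∈ Finset.Icc 1 (t - 1), a s ^ 2 := by
    refine (avg_sq_le ht _).trans ?_
    rw [Finset.mul_sum]
    refine Finset.sum_le_sum fun s hs => ?_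
    rw [mul_pow]
    exact mul_le_mul_of_nonneg_right (pow_le_pow_left₀ (Real.rpow_nonneg (S.L_pos x).le _)
      (h.le s (hmem s hs) x) 2) (sq_nonneg _)
  -- Three denominators, two exact and one perturbed, each at least `(B * B ^ (2 * T))⁻¹`.
  have hden : (q ^ 2 * (q + r))⁻¹ ≤ (B * B ^ (2 * T)) ^ 3 := by
    refine inv_le_of_inv_le₀ (by positivity) ?_
    rw [← inv_pow, pow_succ _ 2]
    exact mul_le_mul (pow_le_pow_left₀ hD.le h1 2) h2 hD.le (sq_nonneg _)
  rw [hrem, abs_mul, abs_mul, abs_of_nonneg (a := r ^ 2 * _) (by positivity)]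
  calc |f x| * (|S.L x ^ S.β t| * (r ^ 2 * (q ^ 2 * (q + r))⁻¹))
      ≤ c * (B * ((B ^ 2 * ∑ s ∈ Finset.Icc 1 (t - 1), a s ^ 2) * (B * B ^ (2 * T)) ^ 3)) := by
        gcongr
        · exact hc x
        · exact h.abs_rpow_le htm x
    _ = _ := by ring

theorem uniformlyBounded_rpow (hS : ∀ i, (S i).Bounds T B) {t : ℕ} (ht : t ∈ Finset.Icc 1 T) :
    UniformlyBounded fun i x => (S i).L x ^ (S i).β t :=
  ⟨fun i => (S i).measurable_rpow t, B, fun i => (hS i).abs_rpow_le ht⟩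

theorem uniformlyBounded_inv_mixtureDensity (hS : ∀ i, (S i).Bounds T B) {t : ℕ} (ht : 2 ≤ t)
    (htT : t ≤ T) : UniformlyBounded fun i x => ((S i).mixtureDensity t (S i).Z x)⁻¹ := by
  refine ⟨fun i => ((S i).measurable_mixtureDensity t _).inv, B * B ^ (2 * T), fun i x => ?_⟩
  have hB := (hS i).pos
  have h1 := ((hS i).mixtureDensity_mem (F := B ^ (2 * T)) (by positivity) ht htT
    (fun s hs => (hS i).Z_mem (by
      have := Finset.mem_Icc.1 hs
      exact Finset.mem_Icc.2 ⟨this.1, by omega⟩)) x).1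
  have h0 : 0 < (S i).mixtureDensity t (S i).Z x :=
    lt_of_lt_of_le (by positivity) h1
  rw [abs_of_pos (inv_pos.2 h0)]
  exact inv_le_of_inv_le₀ (by positivity) h1

/-- The weighted averages over the persistent ensemble approximate the unnormalized target. -/
theorem smallError_weighted (hS : ∀ i, (S i).Bounds T B) {t : ℕ} (ht : 2 ≤ t) (htT : t ≤ T)
    (hA : ∀ s ∈ Finset.Icc 1 (t - 1), PopulationConsistent S N s)
    (hZ : ∀ s ∈ Finset.Icc 1 (t - 1), ConstantConsistent S N s)
    {f : ∀ i, Θ i → ℝ} (hf : UniformlyBounded f) :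
    SmallError (fun i => (S i).law (N i)) (fun i => 1 / (N i : ℝ)) fun i θ =>
      1 / ((t : ℝ) - 1) * ∑ s ∈ Finset.Icc 1 (t - 1),
        empMean (θ s) (fun x => f i x * (S i).weight θ t x) -
        ∫ x, f i x * (S i).L x ^ (S i).β t ∂(S i).prior := by
  have htm : t ∈ Finset.Icc 1 T := Finset.mem_Icc.2 ⟨by omega, htT⟩
  have hmem : ∀ s ∈ Finset.Icc 1 (t - 1), s ∈ Finset.Icc 1 T := fun s hs => by
    have := Finset.mem_Icc.1 hs
    exact Finset.mem_Icc.2 ⟨this.1, by omega⟩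
  -- Exact mixture density `q`, zeroth-order term `g`, and coefficient `k s` of the error of `Ẑ_s⁻¹`
  -- in the expansion of the weighted test function.
  set q : ∀ i, Θ i → ℝ := fun i => (S i).mixtureDensity t (S i).Z with hq
  set g : ∀ i, Θ i → ℝ := fun i x => f i x * ((S i).L x ^ (S i).β t / q i x) with hg
  set k : ℕ → ∀ i, Θ i → ℝ := fun s i x =>
    f i x * ((S i).L x ^ (S i).β s * ((S i).L x ^ (S i).β t / q i x ^ 2)) with hk
  have hqb := uniformlyBounded_inv_mixtureDensity hS ht htT
  have hGt := uniformlyBounded_rpow hS htm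
  have hgb : UniformlyBounded g := by
    simpa only [hg, div_eq_mul_inv] using hf.mul (hGt.mul hqb)
  have hkb : ∀ s ∈ Finset.Icc 1 (t - 1), UniformlyBounded (k s) := fun s hs => by
    have := hf.mul ((uniformlyBounded_rpow hS (hmem s hs)).mul (hGt.mul (hqb.mul hqb)))
    simpa only [hk, div_eq_mul_inv, sq, mul_inv] using this
  have hinv := fun s hs => (hZ s hs).inv hS (hmem s hs)
  -- Centering the empirical mean of `k r` at its target value splits the term into a product of two
  -- small errors and a bounded deterministic multiple of one.
  have hcross : ∀ s ∈ Finset.Icc 1 (t - 1), ∀ r ∈ Finset.Icc 1 (t - 1),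
      SmallError (fun i => (S i).law (N i)) (fun i => 1 / (N i : ℝ)) fun i θ =>
        (((S i).Zhat θ r)⁻¹ - ((S i).Z r)⁻¹) * empMean (θ s) (k r i) := fun s hs r hr => by
    obtain ⟨hkm, c, hc⟩ := hkb r hr
    have hp : ∀ i, |∫ x, k r i x ∂((S i).target s)| ≤ c := fun i =>
      have := (hS i).isProbabilityMeasure_target (hmem s hs)
      abs_integral_le_of_abs_le (hc i)
    exact (((hinv r hr).mul (hA s hs _ (hkb r hr))).add ((hinv r hr).const_mul hp)).congr
      fun i θ => by ring
  have hlin : ∀ s ∈ Finset.Icc 1 (t - 1),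
      SmallError (fun i => (S i).law (N i)) (fun i => 1 / (N i : ℝ)) fun i θ =>
        -(1 / ((t : ℝ) - 1)) * ∑ r ∈ Finset.Icc 1 (t - 1),
          (((S i).Zhat θ r)⁻¹ - ((S i).Z r)⁻¹) * empMean (θ s) (k r i) := fun s hs =>
    (SmallError.sum _ (hcross s hs)).const_mul (a := fun _ => -(1 / ((t : ℝ) - 1)))
      fun _ => le_rfl
  -- The errors of the inverse constants do not depend on the particle, so they pass through the
  -- empirical mean and the remainder can be bounded pointwise.
  have hremeq : ∀ (i : ι) (θ : ℕ → Fin (N i) → Θ i) (s : ℕ),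
      empMean (θ s) (fun x => f i x * (S i).weight θ t x) - (empMean (θ s) (g i) +
        -(1 / ((t : ℝ) - 1)) * ∑ r ∈ Finset.Icc 1 (t - 1),
          (((S i).Zhat θ r)⁻¹ - ((S i).Z r)⁻¹) * empMean (θ s) (k r i)) =
      empMean (θ s) fun x => f i x * (S i).weight θ t x - (g i x +
        -(1 / ((t : ℝ) - 1)) * ∑ r ∈ Finset.Icc 1 (t - 1),
          (((S i).Zhat θ r)⁻¹ - ((S i).Z r)⁻¹) * k r i x) := fun i θ s => by
    simp_rw [sub_eq_add_neg _ (g i _ + _), ← neg_one_mul (g i _ + _), empMean_add,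
      empMean_const_mul, empMean_add, empMean_const_mul, empMean_sum, empMean_const_mul]
    ring
  have hrem : ∀ s ∈ Finset.Icc 1 (t - 1),
      SmallError (fun i => (S i).law (N i)) (fun i => 1 / (N i : ℝ)) fun i θ =>
        empMean (θ s) (fun x => f i x * (S i).weight θ t x) - (empMean (θ s) (g i) +
        -(1 / ((t : ℝ) - 1)) * ∑ r ∈ Finset.Icc 1 (t - 1),
          (((S i).Zhat θ r)⁻¹ - ((S i).Z r)⁻¹) * empMean (θ s) (k r i)) := fun s hs => by
    obtain ⟨hfm, c, hc⟩ := hf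
    refine SmallError.of_abs_le_sum_sq (s := Finset.Icc 1 (t - 1)) hinv (fun i => ?_)
      (A := c * (B * (B ^ 2 * (B * B ^ (2 * T)) ^ 3))) fun i θ => ?_
    · refine ((S i).measurable_empMean_weight t s (hfm i)).sub (Measurable.add ?_ ?_)
      · exact (measurable_empMean (hgb.1 i)).comp (measurable_pi_apply s)
      · exact (hlin s hs).measurable i
    · rw [hremeq]
      exact abs_empMean_le _ fun x => (hS i).abs_remainder_le ht htT (hc i) θ x
  have hpop : ∀ s ∈ Finset.Icc 1 (t - 1),
      SmallError (fun i => (S i).law (N i)) (fun i => 1 / (N i : ℝ)) fun i θ =>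
        empMean (θ s) (fun x => f i x * (S i).weight θ t x) -
          ∫ x, g i x ∂((S i).target s) := fun s hs =>
    (((hrem s hs).add (hlin s hs)).add (hA s hs g hgb)).congr fun i θ => by ring
  refine ((SmallError.sum _ hpop).const_mul (a := fun _ => 1 / ((t : ℝ) - 1))
    fun _ => le_rfl).congr fun i θ => ?_
  obtain ⟨hgm, c, hc⟩ := hgb
  rw [Finset.sum_sub_distrib, mul_sub, (hS i).sum_integral_target htT (hgm i) (hc i)]
  congr 1
  refine integral_congr_ae (Filter.Eventually.of_forall fun x => ?_)
  have hB := (hS i).pos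
  have h1 := ((hS i).mixtureDensity_mem (F := B ^ (2 * T)) (by positivity) ht htT
    (fun s hs => (hS i).Z_mem (hmem s hs)) x).1
  have h0 : (S i).mixtureDensity t (S i).Z x ≠ 0 :=
    (lt_of_lt_of_le (by positivity) h1).ne'
  simp only [hg, hq]
  field_simp

theorem constantConsistent_one (hS : ∀ i, (S i).Bounds T B) : ConstantConsistent S N 1 :=
  (SmallError.zero _ _).congr fun i θ => by simp [Zhat_one, Z, (hS i).β_one]

/-- For the test function `1` the weighted average is `Ẑ_t` itself and its limit is `Z_t`. -/
theorem constantConsistent_of_lt (hS : ∀ i, (S i).Bounds T B) {t : ℕ} (ht : 2 ≤ t) (htT : t ≤ T)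
    (hA : ∀ s ∈ Finset.Icc 1 (t - 1), PopulationConsistent S N s)
    (hZ : ∀ s ∈ Finset.Icc 1 (t - 1), ConstantConsistent S N s) : ConstantConsistent S N t :=
  (smallError_weighted hS ht htT hA hZ (f := fun _ _ => 1)
    ⟨fun _ => measurable_const, 1, by simp⟩).congr fun i θ => by
      simp only [one_mul, Z, Zhat_of_two_le _ _ ht, empMean]

theorem abs_empMean_sub_integral_le {Θ : Type*} [MeasurableSpace Θ] {N : ℕ} [NeZero N]
    (ν : Measure Θ) [IsProbabilityMeasure ν] {f : Θ → ℝ} {c : ℝ} (hc : ∀ x, |f x| ≤ c)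
    (y : Fin N → Θ) : |empMean y f - ∫ x, f x ∂ν| ≤ c + c :=
  (abs_sub _ _).trans (add_le_add (abs_empMean_le y hc) (abs_integral_le_of_abs_le hc))

theorem integral_pi_empMean_sub {Θ : Type*} [MeasurableSpace Θ] {N : ℕ} [NeZero N]
    (ν : Measure Θ) [IsProbabilityMeasure ν] {f : Θ → ℝ} (hf : Measurable f) {c : ℝ}
    (hc : ∀ x, |f x| ≤ c) :
    ∫ y : Fin N → Θ, (empMean y f - ∫ x, f x ∂ν) ∂(Measure.pi fun _ => ν) = 0 := by
  rw [integral_sub (integrable_of_abs_le (measurable_empMean hf) fun y => abs_empMean_le y hc)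
    (integrable_const _), integral_pi_empMean ν hf hc]
  simp

theorem populationConsistent_one (hS : ∀ i, (S i).Bounds T B) : PopulationConsistent S N 1 := by
  rintro f ⟨hfm, c, hc⟩
  simp only [fun i => (hS i).target_one]
  have hm : ∀ i, Measurable fun y : Fin (N i) → Θ i =>
      empMean y (f i) - ∫ x, f i x ∂(S i).prior := fun i =>
    (measurable_empMean (hfm i)).sub_const _
  refine ⟨fun i => (hm i).comp (measurable_pi_apply 1),
    ⟨c + c, fun i θ => abs_empMean_sub_integral_le _ (hc i) _⟩, ⟨0, fun i => ?_⟩,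
    ⟨c ^ 2, fun i => ?_⟩⟩
  · rw [(S i).integral_law_one (hm i), integral_pi_empMean_sub _ (hfm i) (hc i), abs_zero,
      zero_mul]
  · rw [(S i).integral_law_one ((hm i).pow_const 2)]
    exact integral_pi_empMean_sub_sq_le _ (hfm i) (hc i)

theorem measurable_integral_ensemble {Θ : Type*} [MeasurableSpace Θ] (S : Sampler Θ) {N : ℕ}
    [NeZero N] {t : ℕ} (ht : 2 ≤ t) {g : Θ → ℝ} (hg : Measurable g) :
    Measurable fun θ : ℕ → Fin N → Θ => ∫ x, g x ∂(S.ensemble θ t) := by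
  simp_rw [fun θ : ℕ → Fin N → Θ => S.integral_ensemble θ ht hg]
  exact (measurable_const.mul (Finset.measurable_fun_sum _ fun s _ =>
    S.measurable_empMean_weight t s hg)).mul (S.measurable_Zhat t).inv

theorem isProbabilityMeasure_ensemble_bind {Θ : Type*} [MeasurableSpace Θ] (S : Sampler Θ)
    {N : ℕ} [NeZero N] {t : ℕ} (ht : 2 ≤ t) (θ : ℕ → Fin N → Θ) :
    IsProbabilityMeasure ((S.ensemble θ t).bind (S.K t)) :=
  have := S.isProbabilityMeasure_ensemble θ ht
  isProbabilityMeasure_bind (S.K t).measurable.aemeasurable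
    (Filter.Eventually.of_forall fun _ => inferInstance)

/-- The fluctuation of a new population around its conditional mean is a small error. -/
theorem smallError_fluctuation (S : ∀ i, Sampler (Θ i)) (N : ι → ℕ) [∀ i, NeZero (N i)]
    {t : ℕ} (ht : 2 ≤ t) {f : ∀ i, Θ i → ℝ} (hf : UniformlyBounded f) :
    SmallError (fun i => (S i).law (N i)) (fun i => 1 / (N i : ℝ)) fun i θ =>
      empMean (θ t) (f i) - ∫ x, f i x ∂(((S i).ensemble θ t).bind ((S i).K t)) := by
  obtain ⟨hfm, c, hc⟩ := hf
  have hp := fun i (θ : ℕ → Fin (N i) → Θ i) => (S i).isProbabilityMeasure_ensemble_bind ht θ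
  have hmean : ∀ i, Measurable fun θ : ℕ → Fin (N i) → Θ i =>
      ∫ x, f i x ∂(((S i).ensemble θ t).bind ((S i).K t)) := fun i => by
    have he := fun θ : ℕ → Fin (N i) → Θ i => (S i).isProbabilityMeasure_ensemble θ ht
    simp_rw [fun θ : ℕ → Fin (N i) → Θ i =>
      integral_bind_kernel ((S i).ensemble θ t) ((S i).K t) (hfm i) (hc i)]
    exact (S i).measurable_integral_ensemble ht
      (hfm i).stronglyMeasurable.integral_kernel.measurable
  set G : ∀ i, (ℕ → Fin (N i) → Θ i) → (Fin (N i) → Θ i) → ℝ := fun i θ y =>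
    empMean y (f i) - ∫ x, f i x ∂(((S i).ensemble θ t).bind ((S i).K t)) with hG
  have hGm : ∀ i, Measurable (Function.uncurry (G i)) := fun i =>
    ((measurable_empMean (hfm i)).comp measurable_snd).sub ((hmean i).comp measurable_fst)
  have hGc : ∀ i θ y, |G i θ y| ≤ c + c := fun i θ y =>
    have := hp i θ
    abs_empMean_sub_integral_le _ (hc i) y
  have hGpast : ∀ i θ θ', (∀ s ∈ Finset.Icc 1 (t - 1), θ s = θ' s) → G i θ = G i θ' :=
    fun i θ θ' h => by
      simp only [hG]
      rw [(S i).ensemble_congr h]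
  refine ⟨fun i => (hGm i).comp (measurable_id.prodMk (measurable_pi_apply t)),
    ⟨c + c, fun i θ => hGc i θ (θ t)⟩, ⟨0, fun i => ?_⟩, ⟨c ^ 2, fun i => ?_⟩⟩
  -- Given the past, the new particles are i.i.d. from the law at which `G` is centered: the
  -- conditional mean vanishes and the conditional variance is at most `c²/N`.
  · rw [(S i).integral_law_step ht (hGm i) (hGc i) (hGpast i)]
    simp only [hG, nextLaw, integral_pi_empMean_sub _ (hfm i) (hc i), integral_zero, abs_zero,
      zero_mul, le_refl]
  · rw [(S i).integral_law_step ht (G := fun θ y => G i θ y ^ 2) (c := (c + c) ^ 2)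
      ((hGm i).pow_const 2)
      (fun θ y => by
        rw [abs_pow]
        exact pow_le_pow_left₀ (abs_nonneg _) (hGc i θ y) 2)
      (fun θ θ' h => by rw [hGpast i θ θ' h])]
    refine (le_abs_self _).trans (abs_integral_le_of_abs_le fun θ => ?_)
    rw [abs_of_nonneg (integral_nonneg fun y => sq_nonneg _)]
    exact integral_pi_empMean_sub_sq_le _ (hfm i) (hc i)

/-- The conditional mean of `f` is the ensemble average of `K_t f`, a product of a weighted average
and `Ẑ_t⁻¹`, both already controlled. Its limit `p_t(K_t f)` equals `p_t(f)` by invariance. The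
induction hypothesis must cover all bounded test functions because `f` is replaced by `K_t f` and
then multiplied by weight factors. -/
theorem populationConsistent_of_lt (hS : ∀ i, (S i).Bounds T B) {t : ℕ} (ht : 2 ≤ t)
    (htT : t ≤ T) (hA : ∀ s ∈ Finset.Icc 1 (t - 1), PopulationConsistent S N s)
    (hZ : ∀ s ∈ Finset.Icc 1 (t - 1), ConstantConsistent S N s) :
    PopulationConsistent S N t := by
  intro f hf
  have htm : t ∈ Finset.Icc 1 T := Finset.mem_Icc.2 ⟨by omega, htT⟩
  have hfluct := smallError_fluctuation S N ht hf
  obtain ⟨hfm, c, hc⟩ := hf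
  set Kf : ∀ i, Θ i → ℝ := fun i x => ∫ y, f i y ∂((S i).K t x) with hKf
  have hKm : ∀ i, Measurable (Kf i) := fun i =>
    (hfm i).stronglyMeasurable.integral_kernel.measurable
  have hKc : ∀ i x, |Kf i x| ≤ c := fun i x => abs_integral_le_of_abs_le (hc i)
  have hB : ∀ i, |((S i).Z t)⁻¹| ≤ B := fun i => by
    rw [abs_of_pos (inv_pos.2 ((hS i).Z_pos htm))]
    exact inv_le_of_inv_le₀ (hS i).pos ((hS i).inv_le_Z htm)
  have hnum : ∀ i, |∫ x, Kf i x * (S i).L x ^ (S i).β t ∂(S i).prior| ≤ c * B := fun i =>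
    abs_integral_le_of_abs_le fun x => by
      rw [abs_mul]
      exact mul_le_mul (hKc i x) ((hS i).abs_rpow_le htm x) (abs_nonneg _)
        ((abs_nonneg _).trans (hKc i x))
  have hprod := SmallError.mul_sub_mul hnum hB
    (smallError_weighted hS ht htT hA hZ ⟨hKm, c, hKc⟩)
    ((constantConsistent_of_lt hS ht htT hA hZ).inv hS htm)
  refine (hfluct.add hprod).congr fun i θ => ?_
  have := (S i).isProbabilityMeasure_ensemble θ ht
  have := (hS i).isProbabilityMeasure_target htm
  have hinv : ∫ x, f i x ∂((S i).target t) =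
      (∫ x, Kf i x * (S i).L x ^ (S i).β t ∂(S i).prior) * ((S i).Z t)⁻¹ := by
    rw [← ((hS i).invariant t htm).def, integral_bind_kernel _ _ (hfm i) (hc i),
      (hS i).integral_target htm, ← integral_mul_const]
    simp only [hKf, mul_assoc]
  rw [hinv, integral_bind_kernel _ _ (hfm i) (hc i), (S i).integral_ensemble θ ht (hKm i)]
  ring

theorem populationConsistent_and_constantConsistent (hS : ∀ i, (S i).Bounds T B) {t : ℕ}
    (ht : t ∈ Finset.Icc 1 T) : PopulationConsistent S N t ∧ ConstantConsistent S N t := by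
  induction t using Nat.strong_induction_on with
  | _ t ih =>
    obtain ⟨ht1, htT⟩ := Finset.mem_Icc.1 ht
    rcases ht1.eq_or_lt with rfl | ht2
    · exact ⟨populationConsistent_one hS, constantConsistent_one hS⟩
    · have ih' := fun s (hs : s ∈ Finset.Icc 1 (t - 1)) => ih s
        (by have := Finset.mem_Icc.1 hs; omega)
        (Finset.mem_Icc.2 (by have := Finset.mem_Icc.1 hs; omega))
      have hA := fun s hs => (ih' s hs).1
      have hZ := fun s hs => (ih' s hs).2
      exact ⟨populationConsistent_of_lt hS ht2 htT hA hZ,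
        constantConsistent_of_lt hS ht2 htT hA hZ⟩

end Family

/-! ### Uniform constants and the final bound -/

/-- An instance of persistent sampling whose annealed likelihoods are bounded by `B` up to
iteration `T`. -/
structure BoundedInstance (T : ℕ) (B : ℝ) where
  Θ : Type*
  measurableSpace : MeasurableSpace Θ
  sampler : Sampler Θ
  N : ℕ
  neZero : NeZero N
  bounds : sampler.Bounds T B

attribute [instance] BoundedInstance.measurableSpace BoundedInstance.neZero

universe u

/-- The relative bias of `Ẑ_t` is `O(1/N)`, uniformly over all instances of persistent sampling
whose annealed likelihoods satisfy given bounds. -/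
theorem exists_abs_integral_Zhat_div_sub_one_le {t : ℕ} (ht : 1 ≤ t) (B : ℝ) :
    ∃ C : ℝ, ∀ (Θ : Type u) [MeasurableSpace Θ] (S : Sampler Θ), S.Bounds t B →
      ∀ (N : ℕ) [NeZero N], Integrable (fun θ => S.Zhat θ t) (S.law N) ∧
        |(∫ θ, S.Zhat θ t ∂(S.law N)) / S.Z t - 1| ≤ C / N := by
  have htm : t ∈ Finset.Icc 1 t := Finset.mem_Icc.2 ⟨ht, le_rfl⟩
  -- The index type collects every space, sampler and `N` with bound `B`, so a single `c` serves
  -- them all.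
  obtain ⟨c, hc⟩ := (populationConsistent_and_constantConsistent
    (ι := BoundedInstance.{u} t B) (Θ := fun i => i.Θ) (S := fun i => i.sampler)
    (N := fun i => i.N) (fun i => i.bounds) htm).2.bias
  refine ⟨B * c, fun Θ _ S hS N _ => ?_⟩
  have hint : Integrable (fun θ => S.Zhat θ t) (S.law N) :=
    integrable_of_abs_le (S.measurable_Zhat t) (c := B ^ (2 * t)) fun θ => by
      rw [abs_of_pos (S.Zhat_pos θ t)]
      exact (hS.Zhat_mem htm θ).2
  refine ⟨hint, ?_⟩
  have h := hc ⟨Θ, _, S, N, inferInstance, hS⟩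
  dsimp only at h
  rw [integral_sub hint (integrable_const _)] at h
  simp only [integral_const, probReal_univ, one_smul] at h
  have hZ := hS.Z_pos htm
  rw [← div_self hZ.ne', ← sub_div, abs_div, abs_of_pos hZ, div_eq_inv_mul]
  calc (S.Z t)⁻¹ * |∫ θ, S.Zhat θ t ∂(S.law N) - S.Z t|
      ≤ B * (c * (1 / N)) :=
        mul_le_mul (inv_le_of_inv_le₀ hS.pos (hS.inv_le_Z htm)) h (abs_nonneg _) hS.pos.le
    _ = B * c / N := by ring

/-- As `L^{β_1} = 1`, the ratio bounds `M s 1` and `M 1 s` bound `L^{β_s}` and its inverse. The sum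
of all `|M s r|` dominates each of them, and the added `1` ensures `1 ≤ B`. -/
theorem Conditions.bounds {Θ : Type*} [MeasurableSpace Θ] {S : Sampler Θ} {T : ℕ}
    {M : ℕ → ℕ → ℝ} (h : S.Conditions T M) {t : ℕ} (ht : 1 ≤ t) (htT : t ≤ T) :
    S.Bounds t (1 + ∑ s : Set.Icc 1 t, ∑ r : Set.Icc 1 t, |M s r|) := by
  have hM : ∀ s ∈ Finset.Icc 1 t, ∀ r ∈ Finset.Icc 1 t,
      M s r ≤ 1 + ∑ s : Set.Icc 1 t, ∑ r : Set.Icc 1 t, |M s r| := fun s hs r hr => by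
    have h1 := Finset.single_le_sum (f := fun r : Set.Icc 1 t => |M s r|)
      (fun r _ => abs_nonneg _) (Finset.mem_univ ⟨r, Finset.mem_Icc.1 hr⟩)
    have h2 := Finset.single_le_sum
      (f := fun s : Set.Icc 1 t => ∑ r : Set.Icc 1 t, |M s r|)
      (fun s _ => Finset.sum_nonneg fun r _ => abs_nonneg _)
      (Finset.mem_univ ⟨s, Finset.mem_Icc.1 hs⟩)
    dsimp only at h1 h2
    linarith [le_abs_self (M s r)]
  have hT : ∀ s ∈ Finset.Icc 1 t, s ∈ Finset.Icc 1 T := fun s hs =>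
    Finset.Icc_subset_Icc_right htT hs
  have h1 : 1 ∈ Finset.Icc 1 t := Finset.mem_Icc.2 ⟨le_rfl, ht⟩
  refine ⟨le_add_of_nonneg_right (Finset.sum_nonneg fun s _ => Finset.sum_nonneg fun r _ =>
    abs_nonneg _), h.β_one, fun s hs => h.invariant s (hT s hs), fun s hs x => ?_,
    fun s hs x => ?_⟩
  · have := h.likelihood_ratio s (hT s hs) 1 (hT 1 h1) x
    rw [h.β_one, Real.rpow_zero, div_one] at this
    exact this.trans (hM s hs 1 h1)
  · have := h.likelihood_ratio 1 (hT 1 h1) s (hT s hs) x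
    rw [h.β_one, Real.rpow_zero, one_div] at this
    exact inv_le_of_inv_le₀ (Real.rpow_pos_of_pos (S.L_pos x) _) (this.trans (hM 1 h1 s hs))

end Sampler

end PersistentSampling

/-- The constant `C` and the constant `D` in the remainder `O(1/N²)` are functions of `t`, of the
temperatures `β_1, …, β_t` and of the likelihood ratio bounds `M_{sr}`, `s, r ≤ t`, only. -/
theorem mainTheorem3 (t : ℕ) (ht : 3 ≤ t) :
    ∃ C D : (Set.Icc 1 t → ℝ) → (Set.Icc 1 t → Set.Icc 1 t → ℝ) → ℝ,
      ∀ (Θ : Type*) [MeasurableSpace Θ] (S : PersistentSampling.Sampler Θ)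
        (T : ℕ) (M : ℕ → ℕ → ℝ), t ≤ T → S.Conditions T M →
        ∀ (N : ℕ) [NeZero N],
          MeasureTheory.Integrable (fun θ => S.Zhat θ t) (S.law N) ∧
          |(∫ θ, S.Zhat θ t ∂(S.law N)) / S.Z t - 1| ≤
            C (fun s => S.β s) (fun s r => M s r) / (N : ℝ) +
              D (fun s => S.β s) (fun s r => M s r) / (N : ℝ) ^ 2 := by
  choose C hC using fun B : ℝ => PersistentSampling.Sampler.exists_abs_integral_Zhat_div_sub_one_le
    (show 1 ≤ t by omega) B
  -- The bias is already at most a multiple of `1/N`, so the coefficient of `1/N²` can be zero.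
  refine ⟨fun _ M => C (1 + ∑ s, ∑ r, |M s r|), fun _ _ => 0, fun Θ _ S T M htT hS N _ => ?_⟩
  obtain ⟨h1, h2⟩ := hC _ Θ S (hS.bounds (by omega) htT) N
  exact ⟨h1, by simpa using h2⟩
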